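/- Let $\pi:E\to M$ be a smooth fiber bundle, $\dim M=n$, $\dim E=n+m$, and for $0\le l\le\infty$ let $\pi_l:J^l\to M$ be the bundle of $l$-jets of local sections of $\pi$; $[\sigma]_x^l$ denotes the $l$-jet at $x$ of a local section $\sigma$, $j_l\sigma$ its $l$th jet prolongation, and $u_I^\alpha$ are the jet coordinates associated with bundle coordinates $x^i,u^\alpha$. For a $k$th-order differential equation $\mathscr S\subset J^k$, its infinite prolongation $\mathscr S_\infty\subset J^\infty$ is the set of all $[\sigma]_x^\infty$ such that $\operatorname{im} j_k\sigma$ is tangent to $\mathscr S$ at $j_k\sigma(x)$ up to every order $r$, i.e. $j_k\sigma(x)\in\mathscr S$ and, for every smooth function $\Phi$ on a jet-coordinate domain containing $j_k\sigma(x)$ that vanishes on $\mathscr S$, all derivatives of $\Phi\circ j_k\sigma$ at $x$ of order $\le r$ vanish. A holonomic connection $\nabla$ in $\pi_s$ is a connection $J^s\to J^1\pi_s$ with values in $J^{s+1}\subset J^1\pi_s$, i.e. a smooth section $\nabla:J^s\to J^{s+1}$ of the projection $J^{s+1}\to J^s$. In coordinates, it lifts a vector field $X=X^i\partial/\partial x^i$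 on $M$ to the vector field $X^\nabla=X^i\nabla_i$ on $J^s$, where $$\nabla_i=\frac{\partial}{\partial x^i}+\sum_{|I|\le s}(u^\alpha_{Ii}\circ\nabla)\frac{\partial}{\partial u^\alpha_I},$$ and $\nabla$ is flat if its curvature $R^\nabla(X,Y)=[X^\nabla,Y^\nabla]-[X,Y]^\nabla$ vanishes. If $\nabla$ is flat, then for every $\theta\in J^s$ over $x\in M$ there is a local section $s_\theta$ of $\pi$ around $x$, locally unique, with $[s_\theta]_x^s=\theta$ and $j_s s_\theta$ $\nabla$-constant, i.e. $\nabla\circ j_s s_\theta=j_{s+1}s_\theta$; for $0\le r\le\infty$ put $$\nabla_{[r]}:J^s\to J^{s+r+1},\qquad \nabla_{[r]}(\theta):=[s_\theta]_x^{s+r+1}$$ (so that $\nabla_{[0]}=\nabla$). Let $\mathscr Y^\nabla:=\operatorname{im}\nabla\subset J^{s+1}$, viewed as a differential equation on sections of $\pi$, and let $\mathscr Y^\nabla_\infty\subset J^\infty$ be its infinite prolongation. Let $V\to M$ be a smooth vector bundle of finite rank, $F:J^k\to V$ a smooth morphism of bundles over $M$ (a $k$th-order differential operator), $\mathscr E_0=\{\theta\in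 J^k: F(\theta)=0\}$, and let $\mathscr E\subset J^\infty$ be the infinite prolongation of $\mathscr E_0$. **Proposition.** Let $\nabla$ be a flat, holonomic connection in $\pi_s$, $s<k$. Then $\mathscr Y^\nabla_\infty\subset\mathscr E$ if and only if $$F\circ\nabla_{[k-s-1]}=0,$$ that is, if and only if $\nabla$ satisfies the ($s$th, generalized) Hamilton-Jacobi equation of $\mathscr E$. -/

import Mathlib

open scoped Manifold ContDiff Topology

noncomputable section

/-- Euclidean coordinate space `ℝ^n`. -/
abbrev Euc (n : ℕ) : Type := EuclideanSpace ℝ (Fin n)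

/-! ### Multi-indices and partial derivatives -/

/-- Multi-indices `I` with entries in `{1, …, n}` (up to the order of the entries), of length
`|I| ≤ k`. -/
abbrev MultiIndex (n k : ℕ) : Type := {I : Multiset (Fin n) // Multiset.card I ≤ k}

instance MultiIndex.instFinite (n k : ℕ) : Finite (MultiIndex n k) := by
  let f : MultiIndex n k → (j : Fin (k + 1)) × Sym (Fin n) (j : ℕ) :=
    fun I => ⟨⟨Multiset.card I.1, Nat.lt_succ_of_le I.2⟩, ⟨I.1, rfl⟩⟩
  refine Finite.of_injective f ?_
  have h : ∀ I : MultiIndex n k, ((f I).2 : Multiset (Fin n)) = I.1 := fun I => rfl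
  intro I J hIJ
  apply Subtype.ext
  rw [← h I, ← h J, hIJ]

instance MultiIndex.instFintype (n k : ℕ) : Fintype (MultiIndex n k) := Fintype.ofFinite _

/-- The multi-index `Ii`. -/
def MultiIndex.cons {n k : ℕ} (I : MultiIndex n k) (i : Fin n) : MultiIndex n (k + 1) :=
  ⟨i ::ₘ I.1, by simpa using I.2⟩

/-- The iterated partial derivative `∂^{|I|} u / ∂x^I`; for smooth `u` it does not depend on the
order in which the entries of `I` are listed. -/
def partialDeriv {n m : ℕ} (I : Multiset (Fin n)) (u : Euc n → Euc m) : Euc n → Euc m :=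
  I.toList.foldr (fun i v z => fderiv ℝ v z (EuclideanSpace.single i 1)) u

/-- The coordinate space of `k`-jets, with points `(x^i, u_I^α)`, `|I| ≤ k`. -/
abbrev JetCoord (n m k : ℕ) : Type := Euc n × (MultiIndex n k → Euc m)

/-! ### Fiber bundles, bundle coordinates and local sections -/

section Bundle

variable (n m : ℕ)
  {M : Type*} [TopologicalSpace M] [ChartedSpace (Euc n) M]
  {E : Type*} [TopologicalSpace E] [ChartedSpace (Euc (n + m)) E]

/-- `π : E → M` is a smooth fiber bundle with typical fiber `N`: it is locally trivial, with local
trivializations that are diffeomorphisms. -/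
def IsSmoothFiberBundle (N : Type*) [TopologicalSpace N] [ChartedSpace (Euc m) N] (π : E → M) :
    Prop :=
  ∀ x : M, ∃ t : Bundle.Trivialization N π, x ∈ t.baseSet ∧
    ContMDiffOn (𝓡 (n + m)) ((𝓡 n).prod (𝓡 m)) ∞ t t.source ∧
    ContMDiffOn ((𝓡 n).prod (𝓡 m)) (𝓡 (n + m)) ∞ t.toOpenPartialHomeomorph.symm t.target

/-- Bundle coordinates `(x^i, u^α)` on an open subset of `E`, over coordinates `x^i` on an open
subset of `M`. -/
structure BundleChart (π : E → M) where
  /-- the coordinates `(x^i, u^α)` on `E` -/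
  toE : OpenPartialHomeomorph E (Euc n × Euc m)
  /-- the coordinates `x^i` on `M` -/
  toM : OpenPartialHomeomorph M (Euc n)
  toM_mem : toM ∈ IsManifold.maximalAtlas (𝓡 n) ∞ M
  contMDiffOn_toE : ContMDiffOn (𝓡 (n + m)) 𝓘(ℝ, Euc n × Euc m) ∞ toE toE.source
  contMDiffOn_symm : ContMDiffOn 𝓘(ℝ, Euc n × Euc m) (𝓡 (n + m)) ∞ toE.symm toE.target
  map_source : ∀ e ∈ toE.source, π e ∈ toM.source
  fst_toE : ∀ e ∈ toE.source, (toE e).1 = toM (π e)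

variable {n m}

/-- The components `u^α(x)` of a (local) section `σ` in bundle coordinates. -/
def BundleChart.rep {π : E → M} (c : BundleChart n m π) (σ : M → E) : Euc n → Euc m :=
  fun z => (c.toE (σ (c.toM.symm z))).2

variable (n m)

/-- `σ` restricts to a smooth section of `π` on a neighbourhood of `x`. -/
def IsLocalSectionAt (π : E → M) (σ : M → E) (x : M) : Prop :=
  ∀ᶠ y in 𝓝 x, π (σ y) = y ∧ ContMDiffAt (𝓡 n) (𝓡 (n + m)) ∞ σ y

/-- A point `x` of the base with a local section of `π` around `x` (only the values of `sec` near
`pt` matter). -/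
structure PointedSection (π : E → M) where
  /-- the base point -/
  pt : M
  /-- the local section -/
  sec : M → E
  isLocalSectionAt : IsLocalSectionAt n m π sec pt

/-! ### Jets -/

/-- Two local sections have the same `k`-jet (`k ≤ ∞`) at the same point `x`: in bundle
coordinates, their partial derivatives at `x` coincide up to the order `k`. -/
def SameJet {π : E → M} (k : ℕ∞) (p q : PointedSection n m π) : Prop :=
  p.pt = q.pt ∧ p.sec p.pt = q.sec q.pt ∧
    ∀ c : BundleChart n m π, p.sec p.pt ∈ c.toE.source →
      ∀ I : Multiset (Fin n), (Multiset.card I : ℕ∞) ≤ k →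
        partialDeriv I (c.rep p.sec) (c.toM p.pt) = partialDeriv I (c.rep q.sec) (c.toM q.pt)

/-- Having the same `k`-jet is an equivalence relation. -/
def jetSetoid (π : E → M) (k : ℕ∞) : Setoid (PointedSection n m π) where
  r := SameJet n m k
  iseqv :=
    { refl := fun _ => ⟨rfl, rfl, fun _ _ _ _ => rfl⟩
      symm := fun h => ⟨h.1.symm, h.2.1.symm,
        fun c hc I hI => (h.2.2 c (h.2.1 ▸ hc) I hI).symm⟩
      trans := fun h h' => ⟨h.1.trans h'.1, h.2.1.trans h'.2.1,
        fun c hc I hI => (h.2.2 c hc I hI).trans (h'.2.2 c (h.2.1 ▸ hc) I hI)⟩ }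

/-- The space `J^k π` of `k`-jets of local sections of `π`, `k ≤ ∞`. -/
def Jet (π : E → M) (k : ℕ∞) : Type _ := Quotient (jetSetoid n m π k)

variable {n m} {π : E → M}

/-- The jet `[σ]_x^k`. -/
def PointedSection.jet (k : ℕ∞) (p : PointedSection n m π) : Jet n m π k :=
  Quotient.mk (jetSetoid n m π k) p

namespace Jet

/-- The projection `π_k : J^k π → M`. -/
def base {k : ℕ∞} (θ : Jet n m π k) : M :=
  Quotient.lift PointedSection.pt (fun _ _ (h : SameJet n m k _ _) => h.1) θ

/-- The projection `π_{k,0} : J^k π → E`. -/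
def point {k : ℕ∞} (θ : Jet n m π k) : E :=
  Quotient.lift (fun p : PointedSection n m π => p.sec p.pt)
    (fun _ _ (h : SameJet n m k _ _) => h.2.1) θ

/-- The projection `π_{k,h} : J^k π → J^h π`, `h ≤ k`. -/
def trunc {k : ℕ∞} (h : ℕ∞) (hk : h ≤ k) (θ : Jet n m π k) : Jet n m π h :=
  Quotient.lift (PointedSection.jet h)
    (fun _ _ (H : SameJet n m k _ _) =>
      Quotient.sound ⟨H.1, H.2.1, fun c hc I hI => H.2.2 c hc I (hI.trans hk)⟩) θ

end Jet

namespace BundleChart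

variable (c : BundleChart n m π)

/-- The domain in `J^k π` of the jet coordinates associated with bundle coordinates. -/
def jetSource (k : ℕ) : Set (Jet n m π k) := {θ | θ.point ∈ c.toE.source}

/-- The (open) range of the jet coordinates associated with bundle coordinates. -/
def jetTarget (k : ℕ) : Set (JetCoord n m k) :=
  {z | (z.1, z.2 ⟨0, Nat.zero_le k⟩) ∈ c.toE.target}

/-- In coordinates, the `k`th jet prolongation `j_k σ` of a local section `σ`. -/
def jetProlong (k : ℕ) (σ : M → E) : Euc n → JetCoord n m k :=
  fun z => (z, fun I => partialDeriv I.1 (c.rep σ) z)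

open Classical in
/-- The jet coordinates `(x^i, u_I^α)`, `|I| ≤ k`, on `J^k π` associated with bundle coordinates
(with the value `0` outside of their domain). -/
def jetCoord (k : ℕ) (θ : Jet n m π k) : JetCoord n m k :=
  Quotient.lift
    (fun p : PointedSection n m π =>
      if p.sec p.pt ∈ c.toE.source then c.jetProlong k p.sec (c.toM p.pt) else 0)
    (fun p q (h : SameJet n m k p q) => by
      by_cases hp : p.sec p.pt ∈ c.toE.source
      · have hq : q.sec q.pt ∈ c.toE.source := h.2.1 ▸ hp
        simp only [if_pos hp, if_pos hq]
        refine Prod.ext (congrArg c.toM h.1) ?_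
        funext I
        exact h.2.2 c hp I.1 (by exact_mod_cast I.2)
      · have hq : ¬ q.sec q.pt ∈ c.toE.source := h.2.1 ▸ hp
        simp only [if_neg hp, if_neg hq]) θ

end BundleChart

/-- A map from `J^k π` to a manifold is smooth: it is so in jet coordinates. -/
def IsSmoothOnJets {k : ℕ} {F : Type*} [NormedAddCommGroup F] [NormedSpace ℝ F]
    {H : Type*} [TopologicalSpace H] (I : ModelWithCorners ℝ F H)
    {P : Type*} [TopologicalSpace P] [ChartedSpace H P] (f : Jet n m π k → P) : Prop :=
  ∀ c : BundleChart n m π, ∃ g : JetCoord n m k → P,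
    ContMDiffOn 𝓘(ℝ, JetCoord n m k) I ∞ g (c.jetTarget k) ∧
      ∀ θ ∈ c.jetSource k, f θ = g (c.jetCoord k θ)

/-! ### Infinite prolongation of differential equations -/

/-- The image of `j_k σ` is tangent to `S ⊆ J^k π` at `j_k σ (x)` up to the order `r`: the point
`j_k σ (x)` is in `S` and, for every smooth function `Φ` of the jet coordinates which vanishes on
`S`, the function `Φ ∘ j_k σ` vanishes at `x` with all its derivatives of order `≤ r`. -/
def IsTangentUpTo {k : ℕ} (S : Set (Jet n m π k)) (r : ℕ) (p : PointedSection n m π) : Prop :=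
  p.jet k ∈ S ∧
    ∀ c : BundleChart n m π, p.sec p.pt ∈ c.toE.source →
      ∀ Φ : JetCoord n m k → ℝ, ContDiffOn ℝ ∞ Φ (c.jetTarget k) →
        (∀ θ ∈ c.jetSource k, θ ∈ S → Φ (c.jetCoord k θ) = 0) →
          ∀ j ≤ r, iteratedFDeriv ℝ j (fun z => Φ (c.jetProlong k p.sec z)) (c.toM p.pt) = 0

/-- The infinite prolongation of a `k`th order differential equation `S ⊆ J^k π`. -/
def infProlongation {k : ℕ} (S : Set (Jet n m π k)) : Set (Jet n m π ⊤) :=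
  {θ | ∃ p : PointedSection n m π, p.jet ⊤ = θ ∧ ∀ r : ℕ, IsTangentUpTo S r p}

/-! ### Holonomic connections -/

variable (n m π)

/-- A holonomic connection in `π_s : J^s π → M`: a connection `J^s π → J^1 π_s` with values in
`J^{s+1} π ⊆ J^1 π_s`, that is, a smooth section of `π_{s+1,s} : J^{s+1} π → J^s π`. -/
structure HolonomicConnection (s : ℕ) where
  /-- the underlying map -/
  toFun : Jet n m π s → Jet n m π (s + 1 : ℕ)
  trunc_toFun : ∀ θ, (toFun θ).trunc (s : ℕ∞) (by exact_mod_cast Nat.le_succ s) = θ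
  smooth : ∀ c : BundleChart n m π, ∃ g : JetCoord n m s → JetCoord n m (s + 1),
    ContDiffOn ℝ ∞ g (c.jetTarget s) ∧
      ∀ θ ∈ c.jetSource s, c.jetCoord (s + 1) (toFun θ) = g (c.jetCoord s θ)

variable {n m π}

namespace HolonomicConnection

variable {s : ℕ} (D : HolonomicConnection n m π s)

/-- `g` is the expression of the connection in jet coordinates. -/
def IsLocalExpr (c : BundleChart n m π) (g : JetCoord n m s → JetCoord n m (s + 1)) : Prop :=
  ContDiffOn ℝ ∞ g (c.jetTarget s) ∧
    ∀ θ ∈ c.jetSource s, c.jetCoord (s + 1) (D.toFun θ) = g (c.jetCoord s θ)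

/-- In coordinates, the horizontal lift `X^∇ = X^i ∇_i` of a vector field `X = X^i ∂/∂x^i` by the
connection with local expression `g`; here `∇_i = ∂/∂x^i + ∑_{|I| ≤ s} (g_{Ii})^α ∂/∂u_I^α`
(and `g_{Ii} = u_{Ii}` if `|I| < s`). -/
def horizontalLift (g : JetCoord n m s → JetCoord n m (s + 1)) (X : Euc n → Euc n) :
    JetCoord n m s → JetCoord n m s :=
  fun z => (X z.1, fun I => ∑ i : Fin n, X z.1 i • (g z).2 (I.cons i))

/-- The connection is flat: its curvature `R(X, Y) = [X^∇, Y^∇] - [X, Y]^∇` vanishes. -/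
def IsFlat : Prop :=
  ∀ (c : BundleChart n m π) (g : JetCoord n m s → JetCoord n m (s + 1)), D.IsLocalExpr c g →
    ∀ X Y : Euc n → Euc n, ContDiff ℝ ∞ X → ContDiff ℝ ∞ Y → ∀ z ∈ c.jetTarget s,
      VectorField.lieBracket ℝ (horizontalLift g X) (horizontalLift g Y) z
        - horizontalLift g (VectorField.lieBracket ℝ X Y) z = 0

/-- `j_s σ` is, near `x`, a constant section for the connection: `∇ ∘ j_s σ = j_{s+1} σ`, where
`j_{s+1} σ = j_1 (j_s σ)` under the inclusion `J^{s+1} π ⊆ J^1 π_s`. -/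
def IsConstantAt (p : PointedSection n m π) : Prop :=
  ∀ᶠ y in 𝓝 p.pt, ∀ h : IsLocalSectionAt n m π p.sec y,
    D.toFun (PointedSection.jet s ⟨y, p.sec, h⟩) =
      PointedSection.jet ((s + 1 : ℕ) : ℕ∞) ⟨y, p.sec, h⟩

open Classical in
/-- A local section `s_θ` of `π` around `x = π_s(θ)` with `[s_θ]_x^s = θ` and `j_s s_θ` constant
for the connection. If the connection is flat, it exists and is locally unique. (If none exists,
the value is any local section with `s`-jet `θ`.) -/
def leaf (θ : Jet n m π s) : PointedSection n m π :=
  if h : ∃ p : PointedSection n m π, p.jet s = θ ∧ D.IsConstantAt p then h.choose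
  else Quotient.out θ

/-- The map `J^s π → J^l π`, `θ ↦ [s_θ]_x^l`. For `l = s + r + 1` this is `∇_[r]`, with the
indexing in which `∇_[0] = ∇ : J^s π → J^{s+1} π`; in particular `∇_[k-s-1]` takes values in
`J^k π`. -/
def bracket (l : ℕ∞) (θ : Jet n m π s) : Jet n m π l := (D.leaf θ).jet l

end HolonomicConnection

end Bundle

end

/-!
Write `u` for the components of a section in bundle coordinates. A holonomic connection with local
expression `g` prescribes the equation `∂_I u = g_I(x, (∂_J u)_{|J| ≤ s})`, `|I| ≤ s + 1`, that is,
a total differential equation `d a = G(a)` for `a = j_s u`. Its solutions are the constant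
sections. Two facts about them give the theorem.

*Existence* (`HolonomicConnection.IsFlat.exists_isConstantAt`): flatness makes the horizontal
distribution involutive, so through every `s`-jet `θ` there is a constant section, the leaf `s_θ`.
The Frobenius theorem behind it (`ContDiffAt.exists_hasFDerivAt_of_involutive`) is proved without
differentiable dependence of solutions of ordinary differential equations on parameters: the
solution `a` is obtained by integration along rays, and if `w` solves `ẇ = G(w) v`, then by
involutivity `w + t • G(w) h` solves the equation with `v + h` in place of `v` up to `O(‖h‖²)`, so
that Grönwall's inequality gives `a (x + h) = a x + G (a x) h + O(‖h‖²)`. Holonomy then shows that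
the components of `a` are the derivatives of its lowest component.

*Uniqueness to infinite order* (`HolonomicConnection.jet_top_eq_of_isTangentUpTo`): a section
which is tangent to the image of the connection to every order satisfies the equation above to every
order at the base point. Differentiating the equation, its derivatives of order at most `s`
determine all others.

If the prolongation of the image of the connection is contained in that of `{F = 0}`, then this
applies to the `∞`-jet of each leaf, so `F` vanishes at its `k`-jet. Conversely, let `F` vanish on
the `k`-jets of all leaves. By uniqueness, an `∞`-jet in the prolongation of the image of the
connection is the `∞`-jet of a leaf `p`, and the `k`-jets of `p` at nearby points are those of the
leaves through its nearby `s`-jets. So the `k`-jets of `p` stay in `{F = 0}`, which makes `p`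
tangent to `{F = 0}` to every order.
-/

noncomputable section

/-! ### The Frobenius theorem in total form -/

section Frobenius

open Metric Set

variable {X Z : Type*} [NormedAddCommGroup X] [NormedSpace ℝ X]
  [NormedAddCommGroup Z] [NormedSpace ℝ Z]

/-- The Picard–Lindelöf theorem, together with the information that the solution stays in the ball
on which the vector field is controlled. -/
theorem IsPicardLindelof.exists_hasDerivWithinAt_mem_closedBall [CompleteSpace Z]
    {f : ℝ → Z → Z} {tmin tmax : ℝ} {t₀ : Icc tmin tmax} {x₀ : Z} {a L K : NNReal}
    (hf : IsPicardLindelof f t₀ x₀ a 0 L K) :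
    ∃ α : ℝ → Z, α t₀ = x₀ ∧ ∀ t ∈ Icc tmin tmax,
      HasDerivWithinAt α (f t (α t)) (Icc tmin tmax) t ∧ α t ∈ closedBall x₀ a := by
  have hx : x₀ ∈ closedBall x₀ ((0 : NNReal) : ℝ) := mem_closedBall_self le_rfl
  obtain ⟨α, hα⟩ := ODE.FunSpace.exists_isFixedPt_next hf hx
  refine ⟨α.compProj, by rw [ODE.FunSpace.compProj_val, ← hα, ODE.FunSpace.next_apply₀],
    fun t ht ↦ ⟨?_, α.compProj_mem_closedBall hf.mul_max_le⟩⟩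
  refine (ODE.hasDerivWithinAt_picard_Icc t₀.2 hf.continuousOn_uncurry
    α.continuous_compProj.continuousOn (fun _ _ ↦ α.compProj_mem_closedBall hf.mul_max_le)
    x₀ ht).congr_of_mem (fun t' ht' ↦ ?_) ht
  nth_rw 1 [← hα]
  rw [ODE.FunSpace.compProj_of_mem ht', ODE.FunSpace.next_apply]

/-- Near a point where it is `C²`, a map is differentiable, bounded, with bounded and Lipschitz
derivative. -/
theorem ContDiffAt.exists_closedBall_bounds {Y : Type*} [NormedAddCommGroup Y] [NormedSpace ℝ Y]
    {G : Z → Y} {z₀ : Z} (hG : ContDiffAt ℝ 2 G z₀) :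
    ∃ L B C : ℝ, 0 ≤ L ∧ 0 ≤ B ∧ 0 ≤ C ∧ ∀ᶠ r in 𝓝[>] (0 : ℝ),
      ∀ z ∈ closedBall z₀ r, DifferentiableAt ℝ G z ∧ ‖G z‖ ≤ L ∧ ‖fderiv ℝ G z‖ ≤ B ∧
        ∀ z' ∈ closedBall z₀ r, ‖fderiv ℝ G z' - fderiv ℝ G z‖ ≤ C * ‖z' - z‖ := by
  have hG1 : ContDiffAt ℝ 1 (fderiv ℝ G) z₀ := hG.fderiv_right (by norm_num)
  obtain ⟨C, t, ht, hC⟩ := hG1.exists_lipschitzOnWith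
  have h1 : ∀ᶠ z in 𝓝 z₀, DifferentiableAt ℝ G z :=
    ((hG.of_le (by norm_num : (1 : WithTop ℕ∞) ≤ 2)).eventually (by simp)).mono
      fun z hz => hz.differentiableAt (by norm_num)
  have h2 : ∀ᶠ z in 𝓝 z₀, ‖G z‖ ≤ ‖G z₀‖ + 1 :=
    (hG.continuousAt.norm.eventually (gt_mem_nhds (lt_add_one _))).mono fun z hz => hz.le
  have h3 : ∀ᶠ z in 𝓝 z₀, ‖fderiv ℝ G z‖ ≤ ‖fderiv ℝ G z₀‖ + 1 :=
    (hG1.continuousAt.norm.eventually (gt_mem_nhds (lt_add_one _))).mono fun z hz => hz.le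
  refine ⟨‖G z₀‖ + 1, ‖fderiv ℝ G z₀‖ + 1, C, by positivity, by positivity, C.2, ?_⟩
  obtain ⟨R, hR, hball⟩ := Metric.eventually_nhds_iff_ball.1 (((h1.and h2).and h3).and ht)
  filter_upwards [Ioo_mem_nhdsGT hR] with r hr z hz
  have hsub : closedBall z₀ r ⊆ ball z₀ R := closedBall_subset_ball hr.2
  obtain ⟨⟨⟨a, b⟩, c⟩, d⟩ := hball z (hsub hz)
  refine ⟨a, b, c, fun z' hz' => ?_⟩
  simpa [dist_eq_norm] using hC.dist_le_mul z' (hball z' (hsub hz')).2 z d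

/-- Let `w` and `w'` be the solutions of `ẇ = G(w) v` and of `ẇ' = G(w') (v + h)` with a common
initial value. If the distribution spanned by the vectors `(v, G(z) v)` is involutive, then
`t ↦ w + t • G(w) h` solves the second equation up to an error of order `‖h‖ ^ 2`, since its first
order part in `h` is the curvature. Hence `w' 1 = w 1 + G(w 1) h` up to order `‖h‖ ^ 2`. -/
theorem norm_sub_le_of_involutive {G : Z → X →L[ℝ] Z} {z₀ : Z} {r L B C ρ : ℝ}
    (hL₀ : 0 ≤ L) (hB₀ : 0 ≤ B) (hC₀ : 0 ≤ C) (hρ₀ : 0 ≤ ρ)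
    (hd : ∀ z ∈ closedBall z₀ r, DifferentiableAt ℝ G z)
    (hL : ∀ z ∈ closedBall z₀ r, ‖G z‖ ≤ L) (hB : ∀ z ∈ closedBall z₀ r, ‖fderiv ℝ G z‖ ≤ B)
    (hC : ∀ z ∈ closedBall z₀ r, ∀ z' ∈ closedBall z₀ r,
      ‖fderiv ℝ G z' - fderiv ℝ G z‖ ≤ C * ‖z' - z‖)
    (hflat : ∀ z ∈ closedBall z₀ r, ∀ v w, fderiv ℝ G z (G z v) w = fderiv ℝ G z (G z w) v)
    {v h : X} (hvh : ‖v + h‖ ≤ ρ) (hh : L * ‖h‖ ≤ r / 2) {w w' : ℝ → Z}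
    (hw₀ : w 0 = w' 0)
    (hw : ∀ t ∈ Icc (0 : ℝ) 1, HasDerivWithinAt w (G (w t) v) (Icc 0 1) t)
    (hw' : ∀ t ∈ Icc (0 : ℝ) 1, HasDerivWithinAt w' (G (w' t) (v + h)) (Icc 0 1) t)
    (hwm : ∀ t ∈ Icc (0 : ℝ) 1, w t ∈ closedBall z₀ (r / 2))
    (hwm' : ∀ t ∈ Icc (0 : ℝ) 1, w' t ∈ closedBall z₀ (r / 2)) :
    ‖w' 1 - (w 1 + G (w 1) h)‖ ≤
      (B * L + C * L ^ 2 * ρ) / (B * ρ + 1) * (Real.exp (B * ρ + 1) - 1) * ‖h‖ ^ 2 := by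
  have hr0 : 0 ≤ r / 2 := le_trans (by positivity) hh
  have hrr : closedBall z₀ (r / 2) ⊆ closedBall z₀ r := closedBall_subset_closedBall (by linarith)
  have hIci : ∀ t ∈ Ico (0 : ℝ) 1, Icc (0 : ℝ) 1 ∈ 𝓝[≥] t := fun t ht =>
    Filter.mem_of_superset (Icc_mem_nhdsGE ht.2) (Icc_subset_Icc_left ht.1)
  have hstay : ∀ t ∈ Icc (0 : ℝ) 1, w t + t • G (w t) h ∈ closedBall z₀ r := by
    intro t ht
    have h1 := mem_closedBall_iff_norm.1 (hwm t ht)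
    have h2 : ‖t • G (w t) h‖ ≤ r / 2 := by
      rw [norm_smul, Real.norm_eq_abs, abs_of_nonneg ht.1]
      have := (G (w t)).le_of_opNorm_le (hL _ (hrr (hwm t ht))) h
      nlinarith [ht.1, ht.2, norm_nonneg (G (w t) h)]
    rw [mem_closedBall_iff_norm]
    calc ‖w t + t • G (w t) h - z₀‖ = ‖(w t - z₀) + t • G (w t) h‖ := by congr 1; abel
      _ ≤ r / 2 + r / 2 := (norm_add_le _ _).trans (add_le_add h1 h2)
      _ = r := by ring
  have hGw : ∀ t ∈ Icc (0 : ℝ) 1, HasDerivWithinAt (fun t => G (w t))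
      (fderiv ℝ G (w t) (G (w t) v)) (Icc 0 1) t := fun t ht =>
    (hd _ (hrr (hwm t ht))).hasFDerivAt.comp_hasDerivWithinAt t (hw t ht)
  have he : ∀ t ∈ Icc (0 : ℝ) 1, HasDerivWithinAt (fun t => w t + t • G (w t) h)
      (G (w t) v + (t • fderiv ℝ G (w t) (G (w t) v) h + (1 : ℝ) • G (w t) h)) (Icc 0 1) t := by
    intro t ht
    refine (hw t ht).add ((hasDerivWithinAt_id t _).smul (f := fun t => G (w t) h) ?_)
    simpa using (hGw t ht).clm_apply (hasDerivWithinAt_const t _ h)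
  set K : NNReal := ⟨B * ρ + 1, by positivity⟩ with hK
  have hlip : LipschitzOnWith K (fun z => G z (v + h)) (closedBall z₀ r) := by
    refine LipschitzOnWith.of_dist_le_mul fun z hz z' hz' => ?_
    rw [dist_eq_norm, dist_eq_norm]
    have h1 : ‖G z - G z'‖ ≤ B * ‖z - z'‖ :=
      (convex_closedBall z₀ r).norm_image_sub_le_of_norm_fderiv_le hd hB hz' hz
    have h2 : ‖G z (v + h) - G z' (v + h)‖ ≤ B * ‖z - z'‖ * ‖v + h‖ :=
      (G z - G z').le_of_opNorm_le h1 (v + h)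
    refine h2.trans ?_
    change _ ≤ (B * ρ + 1) * ‖z - z'‖
    have : B * ‖z - z'‖ * ‖v + h‖ ≤ B * ‖z - z'‖ * ρ := by gcongr
    nlinarith [norm_nonneg (z - z')]
  have herr : ∀ t ∈ Icc (0 : ℝ) 1,
      dist (G (w t) v + (t • fderiv ℝ G (w t) (G (w t) v) h + (1 : ℝ) • G (w t) h))
        (G (w t + t • G (w t) h) (v + h)) ≤ (B * L + C * L ^ 2 * ρ) * ‖h‖ ^ 2 := by
    intro t ht
    set y := w t with hy
    have hym := hrr (hwm t ht)
    have hyL : ‖G y h‖ ≤ L * ‖h‖ := (G y).le_of_opNorm_le (hL _ hym) h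
    have htL : ‖t • G y h‖ ≤ L * ‖h‖ := by
      rw [norm_smul, Real.norm_eq_abs, abs_of_nonneg ht.1]
      nlinarith [ht.1, ht.2, norm_nonneg (G y h)]
    -- Taylor expansion of `G` to first order on the segment from `y` to `y + t • G y h`
    have hR : ‖G (y + t • G y h) - G y - fderiv ℝ G y (t • G y h)‖ ≤ C * (L * ‖h‖) ^ 2 := by
      have hseg : segment ℝ y (y + t • G y h) ⊆ closedBall z₀ r :=
        (convex_closedBall z₀ r).segment_subset hym (hstay t ht)
      have := (convex_segment y (y + t • G y h)).norm_image_sub_le_of_norm_fderiv_le'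
        (f := G) (φ := fderiv ℝ G y) (C := C * (L * ‖h‖)) (fun z hz => hd z (hseg hz))
        (fun z hz => by
          refine (hC y hym z (hseg hz)).trans ?_
          gcongr
          have := norm_sub_le_of_mem_segment hz
          simp only [add_sub_cancel_left] at this
          exact this.trans htL)
        (left_mem_segment ℝ _ _) (right_mem_segment ℝ _ _)
      rw [add_sub_cancel_left] at this
      refine this.trans ?_
      have : C * (L * ‖h‖) * ‖t • G y h‖ ≤ C * (L * ‖h‖) * (L * ‖h‖) := by gcongr
      nlinarith
    -- by involutivity, only terms of second order in `h` are left
    have key : G y v + (t • fderiv ℝ G y (G y v) h + (1 : ℝ) • G y h)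
        - G (y + t • G y h) (v + h) = - (t • fderiv ℝ G y (G y h) h)
          - (G (y + t • G y h) - G y - fderiv ℝ G y (t • G y h)) (v + h) := by
      rw [hflat y hym v h]
      simp only [map_add, map_smul, sub_apply, smul_apply,
        one_smul]
      abel
    rw [dist_eq_norm, key]
    have h1 : ‖t • fderiv ℝ G y (G y h) h‖ ≤ B * (L * ‖h‖) * ‖h‖ := by
      rw [norm_smul, Real.norm_eq_abs, abs_of_nonneg ht.1]
      have h3 : ‖fderiv ℝ G y (G y h)‖ ≤ B * (L * ‖h‖) :=
        ((fderiv ℝ G y).le_of_opNorm_le (hB y hym) _).trans (by gcongr)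
      have h2 := (fderiv ℝ G y (G y h)).le_of_opNorm_le h3 h
      nlinarith [ht.1, ht.2, norm_nonneg (fderiv ℝ G y (G y h) h)]
    have h2 : ‖(G (y + t • G y h) - G y - fderiv ℝ G y (t • G y h)) (v + h)‖
        ≤ C * (L * ‖h‖) ^ 2 * ρ :=
      (ContinuousLinearMap.le_of_opNorm_le _ hR _).trans (by gcongr)
    calc _ ≤ ‖-(t • fderiv ℝ G y (G y h) h)‖ + _ := norm_sub_le _ _
      _ ≤ B * (L * ‖h‖) * ‖h‖ + C * (L * ‖h‖) ^ 2 * ρ := by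
        rw [norm_neg]; exact add_le_add h1 h2
      _ = _ := by ring
  have hG := dist_le_of_approx_trajectories_ODE_of_mem (a := 0) (b := 1) (K := K)
    (v := fun _ z => G z (v + h)) (s := fun _ => closedBall z₀ r)
    (f := fun t => w t + t • G (w t) h) (g := w') (δ := 0) (εg := 0)
    (fun _ _ => hlip) (fun t ht => (he t ht).continuousWithinAt)
    (fun t ht => (he t (Ico_subset_Icc_self ht)).mono_of_mem_nhdsWithin (hIci t ht))
    (fun t ht => herr t (Ico_subset_Icc_self ht))
    (fun t ht => hstay t (Ico_subset_Icc_self ht))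
    (fun t ht => (hw' t ht).continuousWithinAt)
    (fun t ht => (hw' t (Ico_subset_Icc_self ht)).mono_of_mem_nhdsWithin (hIci t ht))
    (fun t _ => (dist_self _).le) (fun t ht => hrr (hwm' t (Ico_subset_Icc_self ht)))
    (by simp [hw₀]) 1 (by simp)
  have hK0 : (K : ℝ) ≠ 0 := (by positivity : (0 : ℝ) < B * ρ + 1).ne'
  rw [dist_comm, dist_eq_norm, gronwallBound_of_K_ne_0 hK0] at hG
  simp only [one_smul, add_zero, zero_mul, zero_add, sub_zero, mul_one] at hG
  refine hG.trans (le_of_eq ?_)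
  change _ / (B * ρ + 1) * (Real.exp (B * ρ + 1) - 1) = _
  ring

/-- **Frobenius theorem** for a total differential equation `D a = G(a)` with vanishing curvature:
there is a local solution with a given initial value. The solution is obtained by integrating the
equation along the rays that start at `x₀`. -/
theorem ContDiffAt.exists_hasFDerivAt_of_involutive [CompleteSpace Z] {G : Z → X →L[ℝ] Z} {z₀ : Z}
    (hG : ContDiffAt ℝ 2 G z₀)
    (hflat : ∀ᶠ z in 𝓝 z₀, ∀ v w, fderiv ℝ G z (G z v) w = fderiv ℝ G z (G z w) v) (x₀ : X) :
    ∃ a : X → Z, a x₀ = z₀ ∧ ∀ᶠ x in 𝓝 x₀, HasFDerivAt a (G (a x)) x := by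
  obtain ⟨L, B, C, hL₀, hB₀, hC₀, hev⟩ := hG.exists_closedBall_bounds
  obtain ⟨R, hR, hflat⟩ := Metric.eventually_nhds_iff_ball.1 hflat
  obtain ⟨r, hr, hr0, hrR⟩ := (hev.and (Ioo_mem_nhdsGT hR)).exists
  have hflat' : ∀ z ∈ closedBall z₀ r, ∀ v w, fderiv ℝ G z (G z v) w = fderiv ℝ G z (G z w) v :=
    fun z hz => hflat z (closedBall_subset_ball hrR hz)
  have hrr : closedBall z₀ (r / 2) ⊆ closedBall z₀ r := closedBall_subset_closedBall (by linarith)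
  -- for initial velocities of norm at most `ρ`, solutions stay within `r / 2` of `z₀` for time `1`
  set ρ : ℝ := r / (2 * (L + 1)) with hρ
  have hρ0 : 0 < ρ := by positivity
  have hLρ : L * ρ ≤ r / 2 := by
    have : (L + 1) * ρ = r / 2 := by rw [hρ]; field_simp
    nlinarith
  have hsol : ∀ v : X, ∃ w : ℝ → Z, ‖v‖ ≤ ρ → w 0 = z₀ ∧ ∀ t ∈ Icc (0 : ℝ) 1,
      HasDerivWithinAt w (G (w t) v) (Icc 0 1) t ∧ w t ∈ closedBall z₀ (r / 2) := by
    intro v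
    by_cases hv : ‖v‖ ≤ ρ
    swap
    · exact ⟨0, fun h => absurd h hv⟩
    have hpl : IsPicardLindelof (fun _ z => G z v) (⟨0, by simp⟩ : Icc (0 : ℝ) 1) z₀
        ⟨r / 2, by positivity⟩ 0 ⟨L * ρ, by positivity⟩ ⟨B * ρ, by positivity⟩ := by
      refine ⟨fun _ _ => LipschitzOnWith.of_dist_le_mul fun z hz z' hz' => ?_,
        fun _ _ => continuousOn_const, fun _ _ z hz => ?_, ?_⟩
      · rw [dist_eq_norm, dist_eq_norm]
        have h1 : ‖G z - G z'‖ ≤ B * ‖z - z'‖ :=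
          (convex_closedBall z₀ r).norm_image_sub_le_of_norm_fderiv_le
            (fun y hy => (hr y hy).1) (fun y hy => (hr y hy).2.2.1) (hrr hz') (hrr hz)
        have h2 : ‖G z v - G z' v‖ ≤ B * ‖z - z'‖ * ‖v‖ := (G z - G z').le_of_opNorm_le h1 v
        refine h2.trans ?_
        change _ ≤ B * ρ * ‖z - z'‖
        have : B * ‖z - z'‖ * ‖v‖ ≤ B * ‖z - z'‖ * ρ := by gcongr
        linarith
      · exact ((G z).le_of_opNorm_le (hr z (hrr hz)).2.1 v).trans
          (mul_le_mul_of_nonneg_left hv hL₀)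
      · change L * ρ * max (1 - 0) (0 - 0) ≤ r / 2 - 0
        simpa using hLρ
    obtain ⟨w, hw⟩ := hpl.exists_hasDerivWithinAt_mem_closedBall
    exact ⟨w, fun _ => hw⟩
  choose w hw using hsol
  refine ⟨fun x => w (x - x₀) 1, ?_, ?_⟩
  · obtain ⟨h0, h1⟩ := hw 0 (by simpa using hρ0.le)
    have := norm_image_sub_le_of_norm_deriv_le_segment_01' (f := w 0) (C := 0)
      (fun t ht => (h1 t ht).1) (fun t _ => by simp)
    simp only [norm_le_zero_iff, sub_eq_zero] at this
    simp [this, h0]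
  · filter_upwards [ball_mem_nhds x₀ hρ0] with x hx
    rw [hasFDerivAt_iff_isLittleO_nhds_zero]
    refine Asymptotics.IsBigO.trans_isLittleO (g := fun h : X => ‖h‖ ^ 2) ?_
      (Asymptotics.isLittleO_norm_pow_id one_lt_two)
    refine Asymptotics.IsBigO.of_bound
      ((B * L + C * L ^ 2 * ρ) / (B * ρ + 1) * (Real.exp (B * ρ + 1) - 1)) ?_
    have hx' : ‖x - x₀‖ < ρ := mem_ball_iff_norm.1 hx
    have e1 : ∀ᶠ h in 𝓝 (0 : X), ‖x - x₀ + h‖ < ρ :=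
      (continuous_const.add continuous_id).norm.tendsto' 0 ‖x - x₀‖ (by simp)
        |>.eventually (gt_mem_nhds hx')
    have e2 : ∀ᶠ h in 𝓝 (0 : X), L * ‖h‖ < r / 2 :=
      (continuous_const.mul continuous_norm).tendsto' 0 0 (by simp)
        |>.eventually (gt_mem_nhds (half_pos hr0))
    filter_upwards [e1, e2] with h h1 h2
    obtain ⟨a0, a1⟩ := hw (x - x₀) hx'.le
    obtain ⟨b0, b1⟩ := hw (x - x₀ + h) h1.le
    have := norm_sub_le_of_involutive hL₀ hB₀ hC₀ hρ0.le (fun z hz => (hr z hz).1)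
      (fun z hz => (hr z hz).2.1) (fun z hz => (hr z hz).2.2.1)
      (fun z hz => (hr z hz).2.2.2) hflat' h1.le h2.le (a0.trans b0.symm)
      (fun t ht => (a1 t ht).1) (fun t ht => (b1 t ht).1) (fun t ht => (a1 t ht).2)
      (fun t ht => (b1 t ht).2)
    rw [Real.norm_of_nonneg (by positivity), show x + h - x₀ = x - x₀ + h by abel, sub_sub]
    exact this

/-- Solutions of a smooth total differential equation are smooth. -/
theorem contDiffAt_of_hasFDerivAt_comp {G : Z → X →L[ℝ] Z} {a : X → Z} {x₀ : X}
    (hG : ContDiffAt ℝ ∞ G (a x₀)) (ha : ∀ᶠ x in 𝓝 x₀, HasFDerivAt a (G (a x)) x) :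
    ContDiffAt ℝ ∞ a x₀ := by
  refine contDiffAt_infty.2 fun k => ?_
  induction k with
  | zero =>
    refine contDiffAt_zero.2 ⟨{x | HasFDerivAt a (G (a x)) x}, ha, fun x hx => ?_⟩
    exact HasFDerivAt.continuousAt hx |>.continuousWithinAt
  | succ k ih =>
    refine contDiffAt_succ_iff_hasFDerivAt.2 ⟨fun x => G (a x), ⟨_, ha, fun x hx => hx⟩, ?_⟩
    exact (hG.of_le (by exact_mod_cast le_top)).comp x₀ ih

end Frobenius

/-! ### Iterated partial derivatives -/

section PartialDerivatives

variable {n m : ℕ}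

/-- The iterated partial derivative of `u` along a list of coordinate directions, the head of the
list being the direction of the last differentiation. -/
def listDeriv (l : List (Fin n)) (u : Euc n → Euc m) : Euc n → Euc m :=
  l.foldr (fun i v z => fderiv ℝ v z (EuclideanSpace.single i 1)) u

theorem partialDeriv_eq_listDeriv (I : Multiset (Fin n)) (u : Euc n → Euc m) :
    partialDeriv I u = listDeriv I.toList u := rfl

theorem listDeriv_cons (i : Fin n) (l : List (Fin n)) (u : Euc n → Euc m) :
    listDeriv (i :: l) u = fun z => fderiv ℝ (listDeriv l u) z (EuclideanSpace.single i 1) := rfl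

theorem listDeriv_append (l l' : List (Fin n)) (u : Euc n → Euc m) :
    listDeriv (l ++ l') u = listDeriv l (listDeriv l' u) := by
  simp [listDeriv, List.foldr_append]

theorem ContDiffAt.listDeriv {u : Euc n → Euc m} {x : Euc n} (hu : ContDiffAt ℝ ∞ u x)
    (l : List (Fin n)) : ContDiffAt ℝ ∞ (listDeriv l u) x := by
  induction l with
  | nil => exact hu
  | cons i l ih => exact (ih.fderiv_right (m := ∞) (by simp)).clm_apply contDiffAt_const

theorem ContDiffAt.partialDeriv {u : Euc n → Euc m} {x : Euc n} (hu : ContDiffAt ℝ ∞ u x)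
    (I : Multiset (Fin n)) : ContDiffAt ℝ ∞ (partialDeriv I u) x :=
  hu.listDeriv _

theorem Filter.EventuallyEq.listDeriv {u v : Euc n → Euc m} {x : Euc n} (h : u =ᶠ[𝓝 x] v)
    (l : List (Fin n)) : listDeriv l u =ᶠ[𝓝 x] listDeriv l v := by
  induction l with
  | nil => exact h
  | cons i l ih =>
    filter_upwards [ih.eventually_nhds] with z hz
    simp only [listDeriv_cons, Filter.EventuallyEq.fderiv_eq hz]

theorem Filter.EventuallyEq.partialDeriv {u v : Euc n → Euc m} {x : Euc n} (h : u =ᶠ[𝓝 x] v)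
    (I : Multiset (Fin n)) : partialDeriv I u =ᶠ[𝓝 x] partialDeriv I v :=
  h.listDeriv _

/-- Partial derivatives of a smooth map commute. -/
theorem listDeriv_perm {u : Euc n → Euc m} {x : Euc n} (hu : ∀ᶠ z in 𝓝 x, ContDiffAt ℝ ∞ u z)
    {l l' : List (Fin n)} (h : l.Perm l') : listDeriv l u =ᶠ[𝓝 x] listDeriv l' u := by
  induction h with
  | nil => rfl
  | cons i _ ih =>
    filter_upwards [ih.eventually_nhds] with z hz
    simp only [listDeriv_cons, Filter.EventuallyEq.fderiv_eq hz]
  | swap i j l =>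
    filter_upwards [hu] with z hz
    have h1 := hz.listDeriv l
    have h2 : DifferentiableAt ℝ (fderiv ℝ (listDeriv l u)) z :=
      (h1.fderiv_right (m := 1) (right_eq_inf.mp rfl)).differentiableAt (by simp)
    simp only [listDeriv_cons]
    rw [fderiv_clm_apply h2 (by fun_prop), fderiv_clm_apply h2 (by fun_prop)]
    simpa using (h1.isSymmSndFDerivAt (by simpa using ENat.LEInfty.out)).eq _ _
  | trans _ _ ih ih' => exact ih.trans ih'

theorem partialDeriv_coe {u : Euc n → Euc m} {x : Euc n} (hu : ∀ᶠ z in 𝓝 x, ContDiffAt ℝ ∞ u z)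
    (l : List (Fin n)) : partialDeriv (l : Multiset (Fin n)) u =ᶠ[𝓝 x] listDeriv l u :=
  listDeriv_perm hu (Multiset.coe_eq_coe.1 (Multiset.coe_toList _))

theorem partialDeriv_cons {u : Euc n → Euc m} {x : Euc n}
    (hu : ∀ᶠ z in 𝓝 x, ContDiffAt ℝ ∞ u z) (i : Fin n) (I : Multiset (Fin n)) :
    partialDeriv (i ::ₘ I) u =ᶠ[𝓝 x]
      fun z => fderiv ℝ (partialDeriv I u) z (EuclideanSpace.single i 1) := by
  have := partialDeriv_coe hu (i :: I.toList)
  rwa [← Multiset.cons_coe, Multiset.coe_toList] at this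

theorem partialDeriv_add {u : Euc n → Euc m} {x : Euc n}
    (hu : ∀ᶠ z in 𝓝 x, ContDiffAt ℝ ∞ u z) (I J : Multiset (Fin n)) :
    partialDeriv (I + J) u =ᶠ[𝓝 x] partialDeriv I (partialDeriv J u) := by
  have := partialDeriv_coe hu (I.toList ++ J.toList)
  rwa [← Multiset.coe_add, Multiset.coe_toList, Multiset.coe_toList, listDeriv_append] at this

theorem partialDeriv_zero (u : Euc n → Euc m) : partialDeriv 0 u = u := by
  simp [partialDeriv]

theorem listDeriv_eq_iteratedFDeriv {u : Euc n → Euc m} {x : Euc n} (hu : ContDiffAt ℝ ∞ u x)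
    {k : ℕ} (l : Fin k → Fin n) :
    listDeriv (List.ofFn l) u x =
      iteratedFDeriv ℝ k u x (fun a => EuclideanSpace.single (l a) 1) := by
  have hk : ContDiffAt ℝ k u x := hu.of_le (by exact_mod_cast le_top)
  clear hu
  induction k generalizing x with
  | zero => simp [listDeriv]
  | succ k ih =>
    have hd : DifferentiableAt ℝ (iteratedFDeriv ℝ k u) x :=
      (hk.iteratedFDeriv_right (i := k) (m := 1) (by norm_cast; omega)).differentiableAt (by simp)
    rw [hd.iteratedFDeriv_succ_apply_left', List.ofFn_succ, listDeriv_cons]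
    have : listDeriv (List.ofFn fun a => l a.succ) u =ᶠ[𝓝 x] fun z =>
        iteratedFDeriv ℝ k u z (fun a => EuclideanSpace.single (l a.succ) 1) := by
      filter_upwards [hk.eventually (by simp)] with z hz
      exact ih _ (hz.of_le (by exact_mod_cast Nat.le_succ k))
    simp only [this.fderiv_eq]
    rfl

end PartialDerivatives

/-! ### Agreement of Taylor expansions -/

section Agreement

variable {X Y Z : Type*} [NormedAddCommGroup X] [NormedSpace ℝ X]
  [NormedAddCommGroup Y] [NormedSpace ℝ Y] [NormedAddCommGroup Z] [NormedSpace ℝ Z]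

/-- The derivatives of `f` and `g` at `x` agree up to the order `k`. -/
def AgreeTo (k : ℕ) (f g : X → Y) (x : X) : Prop :=
  ∀ j ≤ k, iteratedFDeriv ℝ j f x = iteratedFDeriv ℝ j g x

namespace AgreeTo

theorem refl (k : ℕ) (f : X → Y) (x : X) : AgreeTo k f f x := fun _ _ => rfl

theorem symm {k : ℕ} {f g : X → Y} {x : X} (h : AgreeTo k f g x) : AgreeTo k g f x :=
  fun j hj => (h j hj).symm

theorem trans {k : ℕ} {f g h : X → Y} {x : X} (hfg : AgreeTo k f g x) (hgh : AgreeTo k g h x) :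
    AgreeTo k f h x := fun j hj => (hfg j hj).trans (hgh j hj)

theorem of_eventuallyEq {f g : X → Y} {x : X} (h : f =ᶠ[𝓝 x] g) (k : ℕ) : AgreeTo k f g x :=
  fun j _ => (h.iteratedFDeriv ℝ j).eq_of_nhds

theorem value {k : ℕ} {f g : X → Y} {x : X} (h : AgreeTo k f g x) : f x = g x := by
  simpa using congrArg (fun T => T 0) (h 0 (Nat.zero_le k))

/-- The derivatives of a composition are determined by those of its factors. -/
theorem comp {k : ℕ} {f f' : X → Y} {g g' : Y → Z} {x : X} (hf : ContDiffAt ℝ ∞ f x)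
    (hf' : ContDiffAt ℝ ∞ f' x) (hg : ContDiffAt ℝ ∞ g (f x)) (hg' : ContDiffAt ℝ ∞ g' (f x))
    (h : AgreeTo k f f' x) (h' : AgreeTo k g g' (f x)) : AgreeTo k (g ∘ f) (g' ∘ f') x := by
  intro j hj
  rw [iteratedFDeriv_comp hg hf (by exact_mod_cast le_top),
    iteratedFDeriv_comp (h.value ▸ hg') hf' (by exact_mod_cast le_top), ← h.value]
  refine Finset.sum_congr rfl fun c _ => ?_
  have h1 : ∀ a, ftaylorSeries ℝ f x (c.partSize a) = ftaylorSeries ℝ f' x (c.partSize a) :=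
    fun a => h _ ((c.partSize_le a).trans hj)
  have h2 : ftaylorSeries ℝ g (f x) c.length = ftaylorSeries ℝ g' (f x) c.length :=
    h' _ (c.length_le.trans hj)
  simp only [FormalMultilinearSeries.compAlongOrderedFinpartition, h1, h2]

theorem prodMk {k : ℕ} {f f' : X → Y} {g g' : X → Z} {x : X} (hf : ContDiffAt ℝ ∞ f x)
    (hf' : ContDiffAt ℝ ∞ f' x) (hg : ContDiffAt ℝ ∞ g x) (hg' : ContDiffAt ℝ ∞ g' x)
    (h : AgreeTo k f f' x) (h' : AgreeTo k g g' x) :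
    AgreeTo k (fun z => (f z, g z)) (fun z => (f' z, g' z)) x := by
  intro j hj
  rw [iteratedFDeriv_prodMk hf hg (by exact_mod_cast le_top),
    iteratedFDeriv_prodMk hf' hg' (by exact_mod_cast le_top), h j hj, h' j hj]

theorem pi {ι : Type*} [Fintype ι] {k : ℕ} {f f' : ι → X → Y} {x : X}
    (hf : ∀ i, ContDiffAt ℝ ∞ (f i) x) (hf' : ∀ i, ContDiffAt ℝ ∞ (f' i) x)
    (h : ∀ i, AgreeTo k (f i) (f' i) x) :
    AgreeTo k (fun z i => f i z) (fun z i => f' i z) x := by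
  intro j hj
  ext v i
  have := congrArg (fun T => T v) (h i j hj)
  have e1 := (ContinuousLinearMap.proj (R := ℝ) (φ := fun _ : ι => Y) i).iteratedFDeriv_comp_left
    (contDiffAt_pi.2 hf) (i := j) (by exact_mod_cast le_top)
  have e2 := (ContinuousLinearMap.proj (R := ℝ) (φ := fun _ : ι => Y) i).iteratedFDeriv_comp_left
    (contDiffAt_pi.2 hf') (i := j) (by exact_mod_cast le_top)
  exact (congrArg (fun T => T v) e1).symm.trans (this.trans (congrArg (fun T => T v) e2))

end AgreeTo

theorem agreeTo_of_iteratedFDeriv_sub_eq_zero {f g : X → Y} {x : X} {k : ℕ}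
    (hf : ContDiffAt ℝ ∞ f x) (hg : ContDiffAt ℝ ∞ g x)
    (h : ∀ j ≤ k, iteratedFDeriv ℝ j (fun z => f z - g z) x = 0) : AgreeTo k f g x := by
  intro j hj
  have : iteratedFDeriv ℝ j (f - g) x = 0 := h j hj
  rw [iteratedFDeriv_sub_apply (hf.of_le (by exact_mod_cast le_top))
    (hg.of_le (by exact_mod_cast le_top)), sub_eq_zero] at this
  exact this

/-- Agreement to order `k` is equality of all partial derivatives of order at most `k`. -/
theorem agreeTo_iff_partialDeriv {n m k : ℕ} {u v : Euc n → Euc m} {x : Euc n}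
    (hu : ∀ᶠ z in 𝓝 x, ContDiffAt ℝ ∞ u z) (hv : ∀ᶠ z in 𝓝 x, ContDiffAt ℝ ∞ v z) :
    AgreeTo k u v x ↔ ∀ I : Multiset (Fin n), Multiset.card I ≤ k →
      partialDeriv I u x = partialDeriv I v x := by
  constructor
  · intro h I hI
    have hl : List.ofFn I.toList.get = I.toList := List.ofFn_get _
    rw [partialDeriv_eq_listDeriv, partialDeriv_eq_listDeriv, ← hl,
      listDeriv_eq_iteratedFDeriv hu.self_of_nhds, listDeriv_eq_iteratedFDeriv hv.self_of_nhds,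
      h _ (by simpa using hI)]
  · intro h j hj
    apply ContinuousMultilinearMap.toMultilinearMap_injective
    refine Module.Basis.ext_multilinear
      (fun _ => (EuclideanSpace.basisFun (Fin n) ℝ).toBasis) fun l => ?_
    have := h (List.ofFn l) (by simpa using hj)
    rw [(partialDeriv_coe hu _).eq_of_nhds, (partialDeriv_coe hv _).eq_of_nhds,
      listDeriv_eq_iteratedFDeriv hu.self_of_nhds,
      listDeriv_eq_iteratedFDeriv hv.self_of_nhds] at this
    simpa using this

theorem AgreeTo.partialDeriv {n m k : ℕ} {u v : Euc n → Euc m} {x : Euc n}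
    (hu : ∀ᶠ z in 𝓝 x, ContDiffAt ℝ ∞ u z) (hv : ∀ᶠ z in 𝓝 x, ContDiffAt ℝ ∞ v z)
    {J : Multiset (Fin n)} (h : AgreeTo (k + Multiset.card J) u v x) :
    AgreeTo k (partialDeriv J u) (partialDeriv J v) x := by
  rw [agreeTo_iff_partialDeriv (hu.mono fun z hz => hz.partialDeriv J)
    (hv.mono fun z hz => hz.partialDeriv J)]
  intro I hI
  rw [← (partialDeriv_add hu I J).eq_of_nhds, ← (partialDeriv_add hv I J).eq_of_nhds]
  exact (agreeTo_iff_partialDeriv hu hv).1 h _ (by simpa using hI)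

end Agreement

/-! ### Jets of maps between Euclidean spaces -/

section CoordinateJets

variable {n m s : ℕ}

/-- The `s`th jet prolongation of a map, in coordinates. -/
def jetMap (s : ℕ) (u : Euc n → Euc m) : Euc n → JetCoord n m s :=
  fun z => (z, fun I => partialDeriv I.1 u z)

theorem ContDiffAt.jetMap {u : Euc n → Euc m} {x : Euc n} (hu : ContDiffAt ℝ ∞ u x) (s : ℕ) :
    ContDiffAt ℝ ∞ (jetMap s u) x :=
  contDiffAt_id.prodMk (contDiffAt_pi.2 fun I => hu.partialDeriv I.1)

/-- A differential equation of the form `∂_I u = g_I(x, (∂_J u)_{|J| ≤ s})`, `|I| ≤ s + 1`,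
determines all derivatives of a formal solution at a point by its derivatives of order at most
`s`. -/
theorem agreeTo_of_formal_solution {u v : Euc n → Euc m} {x : Euc n}
    {g : JetCoord n m s → JetCoord n m (s + 1)}
    (hu : ∀ᶠ z in 𝓝 x, ContDiffAt ℝ ∞ u z) (hv : ∀ᶠ z in 𝓝 x, ContDiffAt ℝ ∞ v z)
    (hg : ContDiffAt ℝ ∞ g (jetMap s u x)) (huv : jetMap s u x = jetMap s v x)
    (hgu : ∀ (I : MultiIndex n (s + 1)) (k : ℕ),
      AgreeTo k (partialDeriv I.1 u) (fun z => (g (jetMap s u z)).2 I) x)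
    (hgv : ∀ (I : MultiIndex n (s + 1)) (k : ℕ),
      AgreeTo k (partialDeriv I.1 v) (fun z => (g (jetMap s v z)).2 I) x) (k : ℕ) :
    AgreeTo k u v x := by
  suffices h : ∀ k, AgreeTo (s + k) u v x from fun j hj => h k j (hj.trans (Nat.le_add_left k s))
  intro k
  induction k with
  | zero =>
    rw [agreeTo_iff_partialDeriv hu hv]
    intro I hI
    exact congrFun (congrArg Prod.snd huv) ⟨I, hI⟩
  | succ k ih =>
    have hu0 := hu.self_of_nhds
    have hv0 := hv.self_of_nhds
    have hjet : AgreeTo k (jetMap s u) (jetMap s v) x := by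
      refine AgreeTo.prodMk contDiffAt_id contDiffAt_id
        (contDiffAt_pi.2 fun I => hu0.partialDeriv I.1)
        (contDiffAt_pi.2 fun I => hv0.partialDeriv I.1) (AgreeTo.refl _ _ _)
        (AgreeTo.pi (fun I => hu0.partialDeriv I.1) (fun I => hv0.partialDeriv I.1) fun I => ?_)
      refine AgreeTo.partialDeriv hu hv fun j hj => ih j (hj.trans ?_)
      have := I.2
      omega
    have htop : ∀ I : MultiIndex n (s + 1),
        AgreeTo k (partialDeriv I.1 u) (partialDeriv I.1 v) x := by
      intro I
      have hgI : ContDiffAt ℝ ∞ (fun z => (g z).2 I) (jetMap s u x) :=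
        contDiffAt_pi.1 hg.snd I
      exact ((hgu I k).trans (AgreeTo.comp (hu0.jetMap s) (hv0.jetMap s) hgI hgI hjet
        (AgreeTo.refl _ _ _))).trans (hgv I k).symm
    rw [agreeTo_iff_partialDeriv hu hv]
    intro K hK
    by_cases hKs : Multiset.card K ≤ s + k
    · exact (agreeTo_iff_partialDeriv hu hv).1 ih K hKs
    obtain ⟨I, L, rfl, hI⟩ : ∃ I L : Multiset (Fin n), K = I + L ∧ Multiset.card I = s + 1 := by
      refine ⟨K.toList.take (s + 1), K.toList.drop (s + 1), ?_, ?_⟩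
      · rw [Multiset.coe_add, List.take_append_drop, Multiset.coe_toList]
      · rw [Multiset.coe_card, List.length_take, Multiset.length_toList]
        omega
    rw [add_comm I L, (partialDeriv_add hu L I).eq_of_nhds, (partialDeriv_add hv L I).eq_of_nhds]
    refine (agreeTo_iff_partialDeriv (hu.mono fun z hz => hz.partialDeriv I)
      (hv.mono fun z hz => hz.partialDeriv I)).1 (htop ⟨I, hI.le⟩) L ?_
    rw [Multiset.card_add] at hK
    omega

end CoordinateJets

/-! ### Maps with prescribed partial derivatives -/

section Prescribed

variable {n m : ℕ}

theorem fderiv_prod_smul_single (h : Fin n → ℝ → ℝ) (hd : ∀ j, Differentiable ℝ (h j)) (w : Euc m)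
    (z : Euc n) (i : Fin n) :
    fderiv ℝ (fun x : Euc n => (∏ j, h j (x j)) • w) z (EuclideanSpace.single i 1) =
      (∏ j, Function.update h i (deriv (h i)) j (z j)) • w := by
  have h1 : ∀ j, HasFDerivAt (fun x : Euc n => h j (x j))
      (deriv (h j) (z j) • (EuclideanSpace.proj j : Euc n →L[ℝ] ℝ)) z := fun j =>
    ((hd j).differentiableAt.hasDerivAt (x := z j)).comp_hasFDerivAt z
      (EuclideanSpace.proj j : Euc n →L[ℝ] ℝ).hasFDerivAt
  have h2 := (HasFDerivAt.finsetProd (u := Finset.univ) fun j _ => h1 j).smul_const w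
  have h3 : ∀ j, Function.update h i (deriv (h i)) j (z j) =
      Function.update (fun k => h k (z k)) i (deriv (h i) (z i)) j := by
    intro j
    by_cases hj : j = i
    · subst hj; simp
    · simp [hj]
  rw [h2.fderiv, Finset.prod_congr rfl fun j _ => h3 j,
    Finset.prod_update_of_mem (Finset.mem_univ i), ← Finset.erase_eq]
  simp [mul_comm]

theorem listDeriv_prod_smul (f : Fin n → ℝ → ℝ) (hf : ∀ j, ContDiff ℝ ∞ (f j)) (w : Euc m)
    (l : List (Fin n)) :
    listDeriv l (fun x : Euc n => (∏ j, f j (x j)) • w) =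
      fun x => (∏ j, iteratedDeriv (l.count j) (f j) (x j)) • w := by
  induction l with
  | nil => simp [listDeriv]
  | cons i l ih =>
    rw [listDeriv_cons, ih]
    funext z
    rw [fderiv_prod_smul_single _ (fun j => (hf j).differentiable_iteratedDeriv _
      (by exact_mod_cast ENat.natCast_lt_top _))]
    congr 1
    refine Finset.prod_congr rfl fun j _ => ?_
    by_cases hj : j = i
    · subst hj
      simp [iteratedDeriv_succ]
    · simp [hj, List.count_cons_of_ne (Ne.symm hj)]

theorem listDeriv_sum {ι : Type*} [Fintype ι] (v : ι → Euc n → Euc m)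
    (hv : ∀ a, ContDiff ℝ ∞ (v a)) (l : List (Fin n)) :
    listDeriv l (fun x => ∑ a, v a x) = fun x => ∑ a, listDeriv l (v a) x := by
  induction l with
  | nil => rfl
  | cons i l ih =>
    rw [listDeriv_cons, ih]
    funext z
    rw [fderiv_fun_sum fun a _ =>
      ((hv a).contDiffAt.listDeriv l).differentiableAt (by simp)]
    simp [listDeriv_cons]

/-- Every system of values is the system of partial derivatives of a polynomial map. -/
theorem exists_jetMap_eq {s : ℕ} (z : JetCoord n m s) :
    ∃ u : Euc n → Euc m, ContDiff ℝ ∞ u ∧ jetMap s u z.1 = z := by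
  set p : MultiIndex n s → Fin n → ℝ → ℝ := fun J j t => (t - z.1 j) ^ (J.1.count j) with hp
  have hps : ∀ J j, ContDiff ℝ ∞ (p J j) := fun J j => by fun_prop
  set v : MultiIndex n s → Euc n → Euc m := fun J x => (∏ j, p J j (x j)) •
    ((∏ j, ((J.1.count j).factorial : ℝ))⁻¹ • z.2 J) with hv
  have hvs : ∀ J, ContDiff ℝ ∞ (v J) := fun J =>
    (contDiff_prod fun j _ => (hps J j).comp
      (EuclideanSpace.proj j : Euc n →L[ℝ] ℝ).contDiff).smul contDiff_const
  refine ⟨fun x => ∑ J, v J x, ContDiff.sum fun J _ => hvs J, Prod.ext rfl (funext fun I => ?_)⟩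
  change partialDeriv I.1 _ z.1 = z.2 I
  have hpz : ∀ (J : MultiIndex n s) j, iteratedDeriv (I.1.toList.count j) (p J j) (z.1 j) =
      if I.1.count j = J.1.count j then ((J.1.count j).factorial : ℝ) else 0 := by
    intro J j
    have := congrFun (iteratedDeriv_comp_sub_const (n := I.1.toList.count j)
      (f := fun t : ℝ => t ^ (J.1.count j)) (s := z.1 j)) (z.1 j)
    rw [hp]
    dsimp only at this ⊢
    rw [this, sub_self, iteratedDeriv_fun_pow_zero, ← Multiset.coe_count, Multiset.coe_toList]
    push_cast
    rfl
  rw [partialDeriv_eq_listDeriv, listDeriv_sum v hvs]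
  dsimp only
  rw [Finset.sum_eq_single I]
  · rw [hv, listDeriv_prod_smul _ (hps I)]
    simp only [hpz, if_true, smul_smul]
    rw [mul_inv_cancel₀ (Finset.prod_ne_zero_iff.2 fun j _ => by positivity), one_smul]
  · intro J _ hJ
    rw [hv, listDeriv_prod_smul _ (hps J)]
    obtain ⟨j, hj⟩ : ∃ j, I.1.count j ≠ J.1.count j := by
      by_contra! h
      exact hJ (Subtype.ext (Multiset.ext.2 h).symm)
    dsimp only
    rw [Finset.prod_eq_zero (Finset.mem_univ j), zero_smul]
    rw [hpz, if_neg hj]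
  · simp

end Prescribed

/-! ### Local solutions of flat holonomic equations -/

section LocalSolutions

variable {n m s : ℕ}

/-- The horizontal lift at a point of the space of jets, as a linear map. -/
def horizontalLiftCLM (g : JetCoord n m s → JetCoord n m (s + 1)) (z : JetCoord n m s) :
    Euc n →L[ℝ] JetCoord n m s :=
  (ContinuousLinearMap.id ℝ (Euc n)).prod (ContinuousLinearMap.pi fun I =>
    ∑ i, (EuclideanSpace.proj i : Euc n →L[ℝ] ℝ).smulRight ((g z).2 (I.cons i)))

theorem horizontalLiftCLM_apply (g : JetCoord n m s → JetCoord n m (s + 1)) (z : JetCoord n m s)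
    (v : Euc n) :
    horizontalLiftCLM g z v = HolonomicConnection.horizontalLift g (fun _ => v) z := by
  refine Prod.ext rfl (funext fun I => ?_)
  simp [horizontalLiftCLM, HolonomicConnection.horizontalLift]

theorem horizontalLiftCLM_single (g : JetCoord n m s → JetCoord n m (s + 1)) (z : JetCoord n m s)
    (i : Fin n) (I : MultiIndex n s) :
    (horizontalLiftCLM g z (EuclideanSpace.single i 1)).2 I = (g z).2 (I.cons i) := by
  simp [horizontalLiftCLM]

theorem ContDiffOn.horizontalLiftCLM {g : JetCoord n m s → JetCoord n m (s + 1)}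
    {U : Set (JetCoord n m s)} (hg : ContDiffOn ℝ ∞ g U) :
    ContDiffOn ℝ ∞ (horizontalLiftCLM g) U := by
  refine contDiffOn_clm_apply.2 fun v => ?_
  simp only [horizontalLiftCLM_apply]
  refine contDiffOn_const.prodMk (contDiffOn_pi.2 fun I => ContDiffOn.sum fun i _ => ?_)
  exact (contDiffOn_pi.1 hg.snd (I.cons i)).const_smul (v i)

/-- A holonomic equation `∂_I u = g_I(x, (∂_J u)_{|J| ≤ s})`, `|I| ≤ s + 1`, whose horizontal
distribution is involutive has local solutions with prescribed `s`-jets. -/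
theorem exists_jetMap_solution {U : Set (JetCoord n m s)} (hU : IsOpen U)
    {g : JetCoord n m s → JetCoord n m (s + 1)} (hg : ContDiffOn ℝ ∞ g U)
    (hg₁ : ∀ z ∈ U, (g z).1 = z.1)
    (hg₂ : ∀ z ∈ U, ∀ I : MultiIndex n s, (g z).2 ⟨I.1, I.2.trans (Nat.le_succ s)⟩ = z.2 I)
    (hflat : ∀ v w : Euc n, ∀ z ∈ U,
      VectorField.lieBracket ℝ (HolonomicConnection.horizontalLift g fun _ => v)
        (HolonomicConnection.horizontalLift g fun _ => w) z = 0)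
    {z₀ : JetCoord n m s} (hz₀ : z₀ ∈ U) :
    ∃ u : Euc n → Euc m, (∀ᶠ x in 𝓝 z₀.1, ContDiffAt ℝ ∞ u x) ∧ jetMap s u z₀.1 = z₀ ∧
      ∀ᶠ x in 𝓝 z₀.1, jetMap (s + 1) u x = g (jetMap s u x) := by
  have hG : ∀ z ∈ U, ContDiffAt ℝ ∞ (horizontalLiftCLM g) z := fun z hz =>
    hg.horizontalLiftCLM.contDiffAt (hU.mem_nhds hz)
  have hinv : ∀ z ∈ U, ∀ v w, fderiv ℝ (horizontalLiftCLM g) z (horizontalLiftCLM g z v) w =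
      fderiv ℝ (horizontalLiftCLM g) z (horizontalLiftCLM g z w) v := by
    intro z hz v w
    have hd := (hG z hz).differentiableAt (by simp)
    have key : ∀ v w, fderiv ℝ (HolonomicConnection.horizontalLift g fun _ => w) z
        (HolonomicConnection.horizontalLift g (fun _ => v) z) =
          fderiv ℝ (horizontalLiftCLM g) z (horizontalLiftCLM g z v) w := by
      intro v w
      rw [← horizontalLiftCLM_apply, ← funext fun z => horizontalLiftCLM_apply g z w,
        fderiv_clm_apply hd (by fun_prop)]
      simp
    have := hflat v w z hz
    rwa [VectorField.lieBracket, key, key, sub_eq_zero] at this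
  obtain ⟨a, ha₀, ha⟩ := ((hG z₀ hz₀).of_le ENat.LEInfty.out).exists_hasFDerivAt_of_involutive
    (Filter.eventually_of_mem (hU.mem_nhds hz₀) hinv) z₀.1
  have haU : ∀ᶠ x in 𝓝 z₀.1, a x ∈ U :=
    ha.self_of_nhds.continuousAt.eventually_mem (by rw [ha₀]; exact hU.mem_nhds hz₀)
  have hsm : ∀ᶠ x in 𝓝 z₀.1, ContDiffAt ℝ ∞ a x := by
    filter_upwards [ha.eventually_nhds, haU] with x hx hxU
    exact contDiffAt_of_hasFDerivAt_comp (hG _ hxU) hx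
  have hfst : ∀ᶠ x in 𝓝 z₀.1, (a x).1 = x := by
    obtain ⟨ε, hε, hball⟩ := Metric.eventually_nhds_iff_ball.1 ha
    have hder : ∀ x ∈ Metric.ball z₀.1 ε,
        HasFDerivAt (fun x => (a x).1 - x) (0 : Euc n →L[ℝ] Euc n) x := by
      intro x hx
      exact ((hball x hx).fst.sub (hasFDerivAt_id (𝕜 := ℝ) x)).congr_fderiv
        (sub_eq_zero.2 (ContinuousLinearMap.ext fun v => rfl))
    filter_upwards [Metric.ball_mem_nhds z₀.1 hε] with x hx
    have := (convex_ball z₀.1 ε).norm_image_sub_le_of_norm_hasFDerivWithin_le (C := 0)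
      (fun x hx => (hder x hx).hasFDerivWithinAt) (fun x _ => by simp)
      (Metric.mem_ball_self hε) hx
    simpa [ha₀, sub_eq_zero] using this
  -- by holonomy, the components of `a` are the derivatives of its lowest component
  set u : Euc n → Euc m := fun x => (a x).2 ⟨0, Nat.zero_le s⟩ with hu
  have hus : ∀ᶠ x in 𝓝 z₀.1, ContDiffAt ℝ ∞ u x :=
    hsm.mono fun x hx => contDiffAt_pi.1 hx.snd _
  have hstep : ∀ (I : MultiIndex n s) (i : Fin n),
      partialDeriv I.1 u =ᶠ[𝓝 z₀.1] (fun x => (a x).2 I) →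
        partialDeriv (i ::ₘ I.1) u =ᶠ[𝓝 z₀.1] fun x => (g (a x)).2 (I.cons i) := by
    intro I i hI
    filter_upwards [partialDeriv_cons hus i I.1, hI.eventually_nhds, ha] with x h1 h2 h3
    rw [h1, Filter.EventuallyEq.fderiv_eq h2, ← horizontalLiftCLM_single,
      (hasFDerivAt_pi'.1 h3.snd I).fderiv]
    rfl
  have hall : ∀ (I : Multiset (Fin n)) (hI : Multiset.card I ≤ s),
      partialDeriv I u =ᶠ[𝓝 z₀.1] fun x => (a x).2 ⟨I, hI⟩ := by
    intro I
    induction I using Multiset.induction_on with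
    | empty => intro _; rw [partialDeriv_zero]
    | cons i I ih =>
      intro hI
      have hI' : Multiset.card I ≤ s := by rw [Multiset.card_cons] at hI; omega
      filter_upwards [hstep ⟨I, hI'⟩ i (ih hI'), haU] with x h1 h2
      exact h1.trans (hg₂ _ h2 ⟨i ::ₘ I, hI⟩)
  have hjet : jetMap s u =ᶠ[𝓝 z₀.1] a := by
    filter_upwards [Filter.eventually_all.2 fun I : MultiIndex n s => hall I.1 I.2, hfst]
      with x h1 h2
    exact Prod.ext h2.symm (funext h1)
  have htop : ∀ I : MultiIndex n (s + 1),
      partialDeriv I.1 u =ᶠ[𝓝 z₀.1] fun x => (g (a x)).2 I := by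
    rintro ⟨I, hI⟩
    by_cases hIs : Multiset.card I ≤ s
    · filter_upwards [hall I hIs, haU] with x h1 h2
      exact h1.trans (hg₂ _ h2 ⟨I, hIs⟩).symm
    · obtain ⟨i, hi⟩ := Multiset.card_pos_iff_exists_mem.1 (by omega : 0 < Multiset.card I)
      obtain ⟨J, rfl⟩ := Multiset.exists_cons_of_mem hi
      have hJ : Multiset.card J ≤ s := by rw [Multiset.card_cons] at hI; omega
      exact hstep ⟨J, hJ⟩ i (hall J hJ)
  refine ⟨u, hus, hjet.self_of_nhds.trans ha₀, ?_⟩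
  filter_upwards [Filter.eventually_all.2 htop, hjet, haU] with x h1 h2 h3
  rw [h2]
  have hx : (a x).1 = x := congrArg Prod.fst h2.symm
  exact Prod.ext (hx.symm.trans (hg₁ _ h3).symm) (funext h1)

end LocalSolutions

/-! ### Jets of sections in bundle coordinates -/

section BundleJets

variable {n m : ℕ} {M : Type*} [TopologicalSpace M] [ChartedSpace (Euc n) M]
  {E : Type*} [TopologicalSpace E] [ChartedSpace (Euc (n + m)) E] {π : E → M}

theorem PointedSection.proj_sec (p : PointedSection n m π) : π (p.sec p.pt) = p.pt :=
  p.isLocalSectionAt.self_of_nhds.1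

namespace BundleChart

variable (c : BundleChart n m π)

theorem pt_mem_source {p : PointedSection n m π} (hp : p.sec p.pt ∈ c.toE.source) :
    p.pt ∈ c.toM.source := by
  simpa [p.proj_sec] using c.map_source _ hp

/-- Near a point of the coordinate domain, a local section stays in the coordinate domain. -/
theorem eventually_mem_source {p : PointedSection n m π} (hp : p.sec p.pt ∈ c.toE.source) :
    ∀ᶠ y in 𝓝 p.pt, IsLocalSectionAt n m π p.sec y ∧ p.sec y ∈ c.toE.source ∧
      y ∈ c.toM.source := by
  have h1 : ∀ᶠ y in 𝓝 p.pt, p.sec y ∈ c.toE.source :=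
    p.isLocalSectionAt.self_of_nhds.2.continuousAt.eventually_mem
      (c.toE.open_source.mem_nhds hp)
  filter_upwards [p.isLocalSectionAt.eventually_nhds, h1,
    c.toM.open_source.mem_nhds (c.pt_mem_source hp)] with y h1 h2 h3
  exact ⟨h1, h2, h3⟩

theorem eventually_symm {x : M} (hx : x ∈ c.toM.source) {P : M → Prop} (h : ∀ᶠ y in 𝓝 x, P y) :
    ∀ᶠ z in 𝓝 (c.toM x), z ∈ c.toM.target ∧ P (c.toM.symm z) :=
  Filter.Eventually.and (c.toM.open_target.mem_nhds (c.toM.map_source hx))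
    ((c.toM.eventually_nhds' P hx).2 h)

theorem toE_sec {σ : M → E} {y : M} (hσ : π (σ y) = y) (hy : σ y ∈ c.toE.source) :
    c.toE (σ y) = (c.toM y, c.rep σ (c.toM y)) := by
  have hy' : y ∈ c.toM.source := by simpa [hσ] using c.map_source _ hy
  refine Prod.ext ?_ ?_
  · rw [c.fst_toE _ hy, hσ]
  · rw [rep, c.toM.left_inv hy']

theorem contDiffAt_rep {σ : M → E} {y : M} (hσ : IsLocalSectionAt n m π σ y)
    (hy : σ y ∈ c.toE.source) : ContDiffAt ℝ ∞ (c.rep σ) (c.toM y) := by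
  have hσy := hσ.self_of_nhds
  have hy' : y ∈ c.toM.source := by simpa [hσy.1] using c.map_source _ hy
  have h1 : ContMDiffAt (𝓡 n) (𝓡 n) ∞ c.toM.symm (c.toM y) :=
    contMDiffAt_symm_of_mem_maximalAtlas c.toM_mem (c.toM.map_source hy')
  have h2 : ContMDiffAt (𝓡 n) (𝓡 (n + m)) ∞ σ (c.toM.symm (c.toM y)) := by
    rw [c.toM.left_inv hy']; exact hσy.2
  have h3 : ContMDiffAt (𝓡 (n + m)) 𝓘(ℝ, Euc n × Euc m) ∞ c.toE
      (σ (c.toM.symm (c.toM y))) := by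
    rw [c.toM.left_inv hy']
    exact c.contMDiffOn_toE.contMDiffAt (c.toE.open_source.mem_nhds hy)
  have h4 : ContMDiffAt (𝓡 n) 𝓘(ℝ, Euc n × Euc m) ∞
      (fun z => c.toE (σ (c.toM.symm z))) (c.toM y) :=
    (h3.comp _ h2).comp _ h1
  exact h4.contDiffAt.snd

theorem eventually_contDiffAt_rep {p : PointedSection n m π} (hp : p.sec p.pt ∈ c.toE.source) :
    ∀ᶠ z in 𝓝 (c.toM p.pt), ContDiffAt ℝ ∞ (c.rep p.sec) z := by
  filter_upwards [c.eventually_symm (c.pt_mem_source hp) (c.eventually_mem_source hp)]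
    with z ⟨h1, h2, h3, _⟩
  simpa [c.toM.right_inv h1] using c.contDiffAt_rep h2 h3

theorem jetCoord_jet (k : ℕ) {p : PointedSection n m π} (hp : p.sec p.pt ∈ c.toE.source) :
    c.jetCoord k (p.jet k) = jetMap k (c.rep p.sec) (c.toM p.pt) :=
  if_pos hp

/-- A change of bundle coordinates preserves agreement of sections up to a given order. -/
theorem agreeTo_rep (c' : BundleChart n m π) {k : ℕ} {p q : PointedSection n m π}
    (hpt : p.pt = q.pt) (hpq : p.sec p.pt = q.sec q.pt) (hc : p.sec p.pt ∈ c.toE.source)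
    (hc' : p.sec p.pt ∈ c'.toE.source)
    (h : AgreeTo k (c.rep p.sec) (c.rep q.sec) (c.toM p.pt)) :
    AgreeTo k (c'.rep p.sec) (c'.rep q.sec) (c'.toM p.pt) := by
  set φ : Euc n → Euc n := fun z => c.toM (c'.toM.symm z) with hφ
  set T : Euc n × Euc m → Euc m := fun w => (c'.toE (c.toE.symm w)).2 with hT
  have hrep : ∀ r : PointedSection n m π, r.sec r.pt ∈ c.toE.source →
      r.sec r.pt ∈ c'.toE.source →
      c'.rep r.sec =ᶠ[𝓝 (c'.toM r.pt)] T ∘ (fun x => (x, c.rep r.sec x)) ∘ φ := by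
    intro r hr hr'
    filter_upwards [c'.eventually_symm (c'.pt_mem_source hr')
      ((c.eventually_mem_source hr).and (c'.eventually_mem_source hr'))]
      with z ⟨h1, ⟨h2, h3, _⟩, _⟩
    simp only [Function.comp, hφ, hT, ← c.toE_sec h2.self_of_nhds.1 h3, c.toE.left_inv h3]
    rfl
  have hs := c.pt_mem_source hc
  have hs' := c'.pt_mem_source hc'
  have hφx : φ (c'.toM p.pt) = c.toM p.pt := by rw [hφ]; simp [c'.toM.left_inv hs']
  have hφs : ContDiffAt ℝ ∞ φ (c'.toM p.pt) := by
    have h1 : ContMDiffAt (𝓡 n) (𝓡 n) ∞ c'.toM.symm (c'.toM p.pt) :=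
      contMDiffAt_symm_of_mem_maximalAtlas c'.toM_mem (c'.toM.map_source hs')
    have h2 : ContMDiffAt (𝓡 n) (𝓡 n) ∞ c.toM (c'.toM.symm (c'.toM p.pt)) := by
      rw [c'.toM.left_inv hs']
      exact contMDiffAt_of_mem_maximalAtlas c.toM_mem hs
    exact (h2.comp _ h1).contDiffAt
  have hcq : q.sec q.pt ∈ c.toE.source := hpq ▸ hc
  have hup := c.contDiffAt_rep p.isLocalSectionAt hc
  have huq : ContDiffAt ℝ ∞ (c.rep q.sec) (c.toM p.pt) :=
    hpt ▸ c.contDiffAt_rep q.isLocalSectionAt hcq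
  have hTs : ContDiffAt ℝ ∞ T (c.toM p.pt, c.rep p.sec (c.toM p.pt)) := by
    rw [← c.toE_sec p.proj_sec hc]
    have h1 : ContMDiffAt 𝓘(ℝ, Euc n × Euc m) (𝓡 (n + m)) ∞ c.toE.symm
        (c.toE (p.sec p.pt)) :=
      c.contMDiffOn_symm.contMDiffAt (c.toE.open_target.mem_nhds (c.toE.map_source hc))
    have h2 : ContMDiffAt (𝓡 (n + m)) 𝓘(ℝ, Euc n × Euc m) ∞ c'.toE
        (c.toE.symm (c.toE (p.sec p.pt))) := by
      rw [c.toE.left_inv hc]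
      exact c'.contMDiffOn_toE.contMDiffAt (c'.toE.open_source.mem_nhds hc')
    exact ContDiffAt.snd (h2.comp _ h1).contDiffAt
  have hin : AgreeTo k (fun x => (x, c.rep p.sec x)) (fun x => (x, c.rep q.sec x)) (c.toM p.pt) :=
    AgreeTo.prodMk contDiffAt_id contDiffAt_id hup huq (AgreeTo.refl _ _ _) h
  have hq' := hrep q hcq (hpq ▸ hc')
  rw [← hpt] at hq'
  refine ((AgreeTo.of_eventuallyEq (hrep p hc hc') k).trans ?_).trans
    (AgreeTo.of_eventuallyEq hq' k).symm
  have hup' : ContDiffAt ℝ ∞ (fun x => (x, c.rep p.sec x)) (φ (c'.toM p.pt)) := by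
    rw [hφx]; exact contDiffAt_id.prodMk hup
  have huq' : ContDiffAt ℝ ∞ (fun x => (x, c.rep q.sec x)) (φ (c'.toM p.pt)) := by
    rw [hφx]; exact contDiffAt_id.prodMk huq
  rw [← hφx] at hin hTs
  exact AgreeTo.comp (hup'.comp _ hφs) (huq'.comp _ hφs) hTs hTs
    (AgreeTo.comp hφs hφs hup' huq' (AgreeTo.refl _ _ _) hin) (AgreeTo.refl _ _ _)

/-- Jet coordinates separate the jets in their domain. -/
theorem jetCoord_injOn (k : ℕ) : Set.InjOn (c.jetCoord k) (c.jetSource k) := by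
  intro θ hθ θ' hθ' h
  induction θ using Quotient.ind with | _ p
  induction θ' using Quotient.ind with | _ q
  change p.sec p.pt ∈ c.toE.source at hθ
  change q.sec q.pt ∈ c.toE.source at hθ'
  have h' : jetMap k (c.rep p.sec) (c.toM p.pt) = jetMap k (c.rep q.sec) (c.toM q.pt) := by
    rw [← c.jetCoord_jet k hθ, ← c.jetCoord_jet k hθ']; exact h
  have hM : c.toM p.pt = c.toM q.pt := congrArg Prod.fst h'
  have hpt : p.pt = q.pt := c.toM.injOn (c.pt_mem_source hθ) (c.pt_mem_source hθ') hM
  have hD : ∀ I : MultiIndex n k, partialDeriv I.1 (c.rep p.sec) (c.toM p.pt) =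
      partialDeriv I.1 (c.rep q.sec) (c.toM q.pt) := fun I => congrFun (congrArg Prod.snd h') I
  have hpq : p.sec p.pt = q.sec q.pt := by
    refine c.toE.injOn hθ hθ' ?_
    rw [c.toE_sec p.proj_sec hθ, c.toE_sec q.proj_sec hθ', hM]
    have := hD ⟨0, Nat.zero_le k⟩
    simp only [partialDeriv_zero, hM] at this
    rw [this]
  have hA : AgreeTo k (c.rep p.sec) (c.rep q.sec) (c.toM p.pt) := by
    refine (agreeTo_iff_partialDeriv (c.eventually_contDiffAt_rep hθ)
      (hM ▸ c.eventually_contDiffAt_rep hθ')).2 fun I hI => ?_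
    rw [hD ⟨I, hI⟩, hM]
  refine Quotient.sound ⟨hpt, hpq, fun c' hc' I hI => ?_⟩
  have hc'q : q.sec q.pt ∈ c'.toE.source := hpq ▸ hc'
  have hA' := c.agreeTo_rep c' hpt hpq hθ hc' hA
  rw [← hpt]
  exact (agreeTo_iff_partialDeriv (c'.eventually_contDiffAt_rep hc')
    (hpt ▸ c'.eventually_contDiffAt_rep hc'q)).1 hA' I (by exact_mod_cast hI)

theorem isOpen_jetTarget (k : ℕ) : IsOpen (c.jetTarget k) :=
  c.toE.open_target.preimage (by fun_prop)

theorem jetCoord_mem_jetTarget {k : ℕ} {θ : Jet n m π k} (hθ : θ ∈ c.jetSource k) :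
    c.jetCoord k θ ∈ c.jetTarget k := by
  induction θ using Quotient.ind with | _ p
  change p.sec p.pt ∈ c.toE.source at hθ
  change c.jetCoord k (p.jet k) ∈ _
  rw [c.jetCoord_jet k hθ]
  change (c.toM p.pt, partialDeriv 0 (c.rep p.sec) (c.toM p.pt)) ∈ c.toE.target
  rw [partialDeriv_zero, ← c.toE_sec p.proj_sec hθ]
  exact c.toE.map_source hθ

/-- A smooth map of the coordinates `x^i` defines a local section. -/
theorem exists_pointedSection {x : Euc n} {u : Euc n → Euc m} (hx : (x, u x) ∈ c.toE.target)
    (hu : ∀ᶠ z in 𝓝 x, ContDiffAt ℝ ∞ u z) :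
    ∃ p : PointedSection n m π, c.toM p.pt = x ∧ p.sec p.pt ∈ c.toE.source ∧
      c.rep p.sec =ᶠ[𝓝 x] u := by
  have he := c.toE.map_target hx
  set y₀ : M := π (c.toE.symm (x, u x)) with hy₀
  have hy₀s : y₀ ∈ c.toM.source := c.map_source _ he
  have hy₀x : c.toM y₀ = x := by rw [hy₀, ← c.fst_toE _ he, c.toE.right_inv hx]
  have hcont : ContinuousAt (fun z => (z, u z)) x :=
    continuousAt_id.prodMk hu.self_of_nhds.continuousAt
  have hev : ∀ᶠ z in 𝓝 x, ContDiffAt ℝ ∞ u z ∧ (z, u z) ∈ c.toE.target :=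
    hu.and (hcont.eventually_mem (c.toE.open_target.mem_nhds hx))
  have hevM : ∀ᶠ y in 𝓝 y₀, (ContDiffAt ℝ ∞ u (c.toM y) ∧ (c.toM y, u (c.toM y)) ∈ c.toE.target) ∧
      y ∈ c.toM.source :=
    ((c.toM.continuousAt hy₀s).eventually (by rwa [hy₀x])).and (c.toM.open_source.mem_nhds hy₀s)
  refine ⟨⟨y₀, fun y => c.toE.symm (c.toM y, u (c.toM y)), ?_⟩, hy₀x, ?_, ?_⟩
  · filter_upwards [hevM] with y ⟨⟨h1, h2⟩, h3⟩
    have h4 := c.toE.map_target h2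
    refine ⟨c.toM.injOn (c.map_source _ h4) h3 ?_, ?_⟩
    · rw [← c.fst_toE _ h4, c.toE.right_inv h2]
    · have e1 : ContMDiffAt (𝓡 n) (𝓡 n) ∞ c.toM y :=
        contMDiffAt_of_mem_maximalAtlas c.toM_mem h3
      have e2 : ContMDiffAt (𝓡 n) 𝓘(ℝ, Euc n × Euc m) ∞ (fun z => (z, u z)) (c.toM y) :=
        (contDiffAt_id.prodMk h1).contMDiffAt
      have e3 := c.contMDiffOn_symm.contMDiffAt (c.toE.open_target.mem_nhds h2)
      have e4 : ContMDiffAt (𝓡 n) (𝓡 (n + m)) ∞ (c.toE.symm ∘ fun z => (z, u z)) (c.toM y) :=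
        ContMDiffAt.comp _ e3 e2
      have e5 : ContMDiffAt (𝓡 n) (𝓡 (n + m)) ∞
          ((c.toE.symm ∘ fun z => (z, u z)) ∘ c.toM) y := ContMDiffAt.comp y e4 e1
      exact e5
  · change c.toE.symm (c.toM y₀, u (c.toM y₀)) ∈ c.toE.source
    rwa [hy₀x]
  · rw [← hy₀x]
    filter_upwards [c.eventually_symm hy₀s hevM] with z ⟨h1, ⟨_, h2⟩, _⟩
    rw [c.toM.right_inv h1] at h2
    simp only [rep, c.toM.right_inv h1, c.toE.right_inv h2]

theorem exists_jetCoord_eq {k : ℕ} {z : JetCoord n m k} (hz : z ∈ c.jetTarget k) :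
    ∃ θ ∈ c.jetSource k, c.jetCoord k θ = z := by
  obtain ⟨u, hu, huz⟩ := exists_jetMap_eq z
  have h0 : u z.1 = z.2 ⟨0, Nat.zero_le k⟩ := by
    rw [← congrFun (congrArg Prod.snd huz) ⟨0, Nat.zero_le k⟩]
    exact (congrFun (partialDeriv_zero u) z.1).symm
  obtain ⟨p, hp, hps, hpu⟩ := c.exists_pointedSection (x := z.1) (u := u)
    (by rw [h0]; exact hz) (Filter.Eventually.of_forall fun x => hu.contDiffAt)
  refine ⟨p.jet k, hps, ?_⟩
  rw [c.jetCoord_jet k hps, hp, ← huz]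
  exact Prod.ext rfl (funext fun I => (hpu.partialDeriv I.1).eq_of_nhds)

end BundleChart

theorem Jet.point_trunc {k h : ℕ∞} (hk : h ≤ k) (θ : Jet n m π k) :
    (θ.trunc h hk).point = θ.point := by
  induction θ using Quotient.ind with | _ p
  rfl

theorem BundleChart.jetCoord_trunc (c : BundleChart n m π) {k h : ℕ} (hk : h ≤ k)
    {θ : Jet n m π k} (hθ : θ ∈ c.jetSource k) :
    c.jetCoord h (θ.trunc (h : ℕ∞) (by exact_mod_cast hk)) =
      ((c.jetCoord k θ).1, fun I => (c.jetCoord k θ).2 ⟨I.1, I.2.trans hk⟩) := by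
  induction θ using Quotient.ind with | _ p
  change p.sec p.pt ∈ c.toE.source at hθ
  change c.jetCoord h (p.jet h) = ((c.jetCoord k (p.jet k)).1, fun I =>
    (c.jetCoord k (p.jet k)).2 ⟨I.1, I.2.trans hk⟩)
  rw [c.jetCoord_jet k hθ, c.jetCoord_jet h hθ]
  rfl

/-- Every point of a smooth fiber bundle is in the domain of bundle coordinates. -/
theorem IsSmoothFiberBundle.exists_bundleChart [IsManifold (𝓡 n) ∞ M]
    {N : Type*} [TopologicalSpace N] [ChartedSpace (Euc m) N] [IsManifold (𝓡 m) ∞ N]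
    (hπ : IsSmoothFiberBundle n m N π) (e : E) :
    ∃ c : BundleChart n m π, e ∈ c.toE.source := by
  obtain ⟨t, ht, hts, hts'⟩ := hπ (π e)
  have het : e ∈ t.source := t.mem_source.2 ht
  set a := chartAt (Euc n) (π e) with ha
  set b := chartAt (Euc m) (t e).2 with hb
  have hsm : ContMDiffOn ((𝓡 n).prod (𝓡 m)) 𝓘(ℝ, Euc n × Euc m) ∞ (a.prod b)
      (a.prod b).source := by
    rw [modelWithCornersSelf_prod, ← chartedSpaceSelf_prod]
    exact ContMDiffOn.prodMap contMDiffOn_chart contMDiffOn_chart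
  have hsm' : ContMDiffOn 𝓘(ℝ, Euc n × Euc m) ((𝓡 n).prod (𝓡 m)) ∞ (a.prod b).symm
      (a.prod b).target := by
    rw [modelWithCornersSelf_prod, ← chartedSpaceSelf_prod]
    exact ContMDiffOn.prodMap contMDiffOn_chart_symm contMDiffOn_chart_symm
  have hfst : ∀ e' ∈ (t.toOpenPartialHomeomorph.trans (a.prod b)).source,
      π e' ∈ a.source ∧ (t e').1 = π e' := by
    intro e' he'
    rw [OpenPartialHomeomorph.trans_source] at he'
    have h1 : (t e').1 = π e' := t.coe_fst he'.1
    exact ⟨h1 ▸ (Set.mem_prod.1 he'.2).1, h1⟩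
  refine ⟨⟨t.toOpenPartialHomeomorph.trans (a.prod b), a,
    IsManifold.chart_mem_maximalAtlas _, ?_, ?_, fun e' he' => (hfst e' he').1,
    fun e' he' => ?_⟩, ?_⟩
  · exact hsm.comp (hts.mono fun e' he' => he'.1) fun e' he' => he'.2
  · exact hts'.comp (hsm'.mono fun z hz => hz.1) fun z hz => hz.2
  · change a (t e').1 = a (π e')
    rw [(hfst e' he').2]
  · refine ⟨het, ?_⟩
    have : (t e).1 = π e := t.coe_fst het
    exact ⟨by change (t e).1 ∈ _; rw [this]; exact mem_chart_source _ _, mem_chart_source _ _⟩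

end BundleJets

/-! ### Flat holonomic connections -/

section Connections

variable {n m s : ℕ} {M : Type*} [TopologicalSpace M] [ChartedSpace (Euc n) M]
  {E : Type*} [TopologicalSpace E] [ChartedSpace (Euc (n + m)) E] {π : E → M}

/-- If all `k`-jets of a section at points near the base point are in `S`, then its prolongation
is tangent to `S` to every order. -/
theorem isTangentUpTo_of_eventually {k : ℕ} {S : Set (Jet n m π k)} {p : PointedSection n m π}
    (h : ∀ᶠ y in 𝓝 p.pt, ∀ h : IsLocalSectionAt n m π p.sec y,
      PointedSection.jet k ⟨y, p.sec, h⟩ ∈ S) (r : ℕ) : IsTangentUpTo S r p := by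
  refine ⟨h.self_of_nhds p.isLocalSectionAt, fun c hc Φ _ hΦ j _ => ?_⟩
  have h0 : (fun z => Φ (c.jetProlong k p.sec z)) =ᶠ[𝓝 (c.toM p.pt)] fun _ => 0 := by
    filter_upwards [c.eventually_symm (c.pt_mem_source hc)
      (h.and (c.eventually_mem_source hc))] with z ⟨h1, h2, h3, h4, _⟩
    have := hΦ (PointedSection.jet k ⟨c.toM.symm z, p.sec, h3⟩) h4 (h2 h3)
    rw [c.jetCoord_jet k (p := ⟨c.toM.symm z, p.sec, h3⟩) h4] at this
    simp only [c.toM.right_inv h1] at this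
    exact this
  rw [(h0.iteratedFDeriv ℝ j).eq_of_nhds]
  exact congrFun iteratedFDeriv_fun_zero _

namespace HolonomicConnection

variable {D : HolonomicConnection n m π s}

theorem mem_jetSource_toFun (D : HolonomicConnection n m π s) (c : BundleChart n m π)
    {θ : Jet n m π s} : D.toFun θ ∈ c.jetSource (s + 1) ↔ θ ∈ c.jetSource s := by
  have : (D.toFun θ).point = θ.point := by
    rw [← Jet.point_trunc (h := (s : ℕ∞)) (by exact_mod_cast Nat.le_succ s) (D.toFun θ),
      D.trunc_toFun]
  simp [BundleChart.jetSource, this]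

/-- In jet coordinates, a holonomic connection is a section of the truncation map. -/
theorem jetCoord_toFun (D : HolonomicConnection n m π s) (c : BundleChart n m π)
    {θ : Jet n m π s} (hθ : θ ∈ c.jetSource s) :
    c.jetCoord s θ = ((c.jetCoord (s + 1) (D.toFun θ)).1, fun I =>
      (c.jetCoord (s + 1) (D.toFun θ)).2 ⟨I.1, I.2.trans (Nat.le_succ s)⟩) := by
  rw [← c.jetCoord_trunc (Nat.le_succ s) ((D.mem_jetSource_toFun c).2 hθ), D.trunc_toFun]

/-- The local expression of a connection is a section of the truncation map on all of the range of
the jet coordinates, since every point of that range is the jet of a polynomial section. -/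
theorem IsLocalExpr.trunc_eq {c : BundleChart n m π} {g : JetCoord n m s → JetCoord n m (s + 1)}
    (hg : D.IsLocalExpr c g) {z : JetCoord n m s} (hz : z ∈ c.jetTarget s) :
    z = ((g z).1, fun I => (g z).2 ⟨I.1, I.2.trans (Nat.le_succ s)⟩) := by
  obtain ⟨θ, hθ, rfl⟩ := c.exists_jetCoord_eq hz
  rw [← hg.2 θ hθ]
  exact D.jetCoord_toFun c hθ

/-- **Frobenius theorem** for holonomic connections: through every point of the space of jets
there is a constant section. -/
theorem IsFlat.exists_isConstantAt [IsManifold (𝓡 n) ∞ M]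
    {N : Type*} [TopologicalSpace N] [ChartedSpace (Euc m) N] [IsManifold (𝓡 m) ∞ N]
    (hπ : IsSmoothFiberBundle n m N π) (hD : D.IsFlat) (θ : Jet n m π s) :
    ∃ p : PointedSection n m π, p.jet s = θ ∧ D.IsConstantAt p := by
  obtain ⟨c, hc⟩ := hπ.exists_bundleChart θ.point
  obtain ⟨g, hg⟩ : ∃ g, D.IsLocalExpr c g := D.smooth c
  have hθ : θ ∈ c.jetSource s := hc
  have hz := c.jetCoord_mem_jetTarget hθ
  obtain ⟨u, hu, hu₀, hug⟩ := exists_jetMap_solution (c.isOpen_jetTarget s) hg.1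
    (fun z hz => (congrArg Prod.fst (hg.trunc_eq hz)).symm)
    (fun z hz I => (congrFun (congrArg Prod.snd (hg.trunc_eq hz)) I).symm)
    (fun v w z hz => by
      have := hD c g hg (fun _ => v) (fun _ => w) contDiff_const contDiff_const z hz
      have h0 : horizontalLift g (VectorField.lieBracket ℝ (fun _ : Euc n => v) fun _ => w) z =
          0 := by
        have : VectorField.lieBracket ℝ (fun _ : Euc n => v) (fun _ => w) = 0 := by
          funext x
          simp [VectorField.lieBracket]
        rw [this]
        exact (horizontalLiftCLM_apply g z 0).symm.trans (map_zero _)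
      rwa [h0, sub_zero] at this) hz
  obtain ⟨p, hp, hps, hpu⟩ := c.exists_pointedSection (u := u) (by
    have : u (c.jetCoord s θ).1 = (c.jetCoord s θ).2 ⟨0, Nat.zero_le s⟩ := by
      rw [← congrFun (congrArg Prod.snd hu₀) ⟨0, Nat.zero_le s⟩]
      exact (congrFun (partialDeriv_zero u) _).symm
    rw [this]
    exact hz) hu
  -- near the base point, the jets of `p` have the coordinates `jetMap _ u`
  have hjet : ∀ᶠ y in 𝓝 p.pt, ∀ h : IsLocalSectionAt n m π p.sec y, p.sec y ∈ c.toE.source ∧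
      (∀ k : ℕ, c.jetCoord k (PointedSection.jet k ⟨y, p.sec, h⟩) = jetMap k u (c.toM y)) ∧
      jetMap (s + 1) u (c.toM y) = g (jetMap s u (c.toM y)) := by
    have hcont := c.toM.continuousAt (c.pt_mem_source hps)
    rw [← hp] at hpu hug
    filter_upwards [c.eventually_mem_source hps, hcont.eventually hpu.eventually_nhds,
      hcont.eventually hug] with y ⟨_, h2, _⟩ h3 h4 h
    refine ⟨h2, fun k => ?_, h4⟩
    rw [c.jetCoord_jet k (p := ⟨y, p.sec, h⟩) h2]
    exact Prod.ext rfl (funext fun I => (Filter.EventuallyEq.partialDeriv h3 I.1).eq_of_nhds)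
  refine ⟨p, c.jetCoord_injOn s hps hθ ?_, ?_⟩
  · exact ((hjet.self_of_nhds p.isLocalSectionAt).2.1 s).trans (by rw [hp, hu₀])
  · filter_upwards [hjet] with y hy h
    obtain ⟨h1, h2, h3⟩ := hy h
    refine c.jetCoord_injOn (s + 1) ((D.mem_jetSource_toFun c).2 h1) h1 ?_
    rw [hg.2 _ h1, h2 s, h2 (s + 1), h3]

theorem IsConstantAt.isTangentUpTo {p : PointedSection n m π} (hp : D.IsConstantAt p) (r : ℕ) :
    IsTangentUpTo (Set.range D.toFun) r p :=
  isTangentUpTo_of_eventually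
    (Filter.Eventually.mono hp fun _ hy h => Set.mem_range.2 ⟨_, hy h⟩) r

theorem IsConstantAt.eventually {p : PointedSection n m π} (hp : D.IsConstantAt p) :
    ∀ᶠ y in 𝓝 p.pt, ∀ h : IsLocalSectionAt n m π p.sec y, D.IsConstantAt ⟨y, p.sec, h⟩ := by
  filter_upwards [Filter.Eventually.eventually_nhds hp] with y hy h
  exact hy

/-- In coordinates, tangency to the image of a connection with local expression `g` to every
order means that `∂_I u = g_I(x, (∂_J u)_{|J| ≤ s})` holds to every order at the base point. -/
theorem IsLocalExpr.agreeTo_of_isTangentUpTo {c : BundleChart n m π}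
    {g : JetCoord n m s → JetCoord n m (s + 1)} (hg : D.IsLocalExpr c g)
    {p : PointedSection n m π} (hc : p.sec p.pt ∈ c.toE.source)
    (hp : ∀ r, IsTangentUpTo (Set.range D.toFun) r p) (I : MultiIndex n (s + 1)) (k : ℕ) :
    AgreeTo k (partialDeriv I.1 (c.rep p.sec)) (fun z => (g (jetMap s (c.rep p.sec) z)).2 I)
      (c.toM p.pt) := by
  set τ : JetCoord n m (s + 1) → JetCoord n m s :=
    fun z => (z.1, fun I => z.2 ⟨I.1, I.2.trans (Nat.le_succ s)⟩) with hτ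
  have hτs : ContDiff ℝ ∞ τ :=
    contDiff_fst.prodMk (contDiff_pi.2 fun I => contDiff_pi.1 contDiff_snd _)
  have hu := c.contDiffAt_rep p.isLocalSectionAt hc
  have hpz : jetMap s (c.rep p.sec) (c.toM p.pt) ∈ c.jetTarget s := by
    rw [← c.jetCoord_jet s hc]
    exact c.jetCoord_mem_jetTarget hc
  have hgu : ContDiffAt ℝ ∞ (fun z => g (jetMap s (c.rep p.sec) z)) (c.toM p.pt) :=
    (hg.1.contDiffAt ((c.isOpen_jetTarget s).mem_nhds hpz)).comp _ (hu.jetMap s)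
  have hguI : ContDiffAt ℝ ∞ (fun z => (g (jetMap s (c.rep p.sec) z)).2 I) (c.toM p.pt) :=
    contDiffAt_pi.1 hgu.snd I
  refine agreeTo_of_iteratedFDeriv_sub_eq_zero (hu.partialDeriv I.1) hguI fun j hj => ?_
  have hsub : ContDiffAt ℝ ∞ (fun z => partialDeriv I.1 (c.rep p.sec) z -
      (g (jetMap s (c.rep p.sec) z)).2 I) (c.toM p.pt) := (hu.partialDeriv I.1).sub hguI
  -- the functions `u_I^α - g_I^α` on the coordinate domain vanish on the image of the connection
  have hα : ∀ α : Fin m, iteratedFDeriv ℝ j ((EuclideanSpace.proj α : Euc m →L[ℝ] ℝ) ∘ fun z =>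
      partialDeriv I.1 (c.rep p.sec) z - (g (jetMap s (c.rep p.sec) z)).2 I) (c.toM p.pt) = 0 := by
    intro α
    refine (hp j).2 c hc (fun z => (z.2 I - (g (τ z)).2 I) α) ?_ ?_ j le_rfl
    · have hgτ : ContDiffOn ℝ ∞ (fun z => g (τ z)) (c.jetTarget (s + 1)) :=
        hg.1.comp hτs.contDiffOn fun z hz => hz
      have h1 : ContDiffOn ℝ ∞ (fun z : JetCoord n m (s + 1) => z.2 I - (g (τ z)).2 I)
          (c.jetTarget (s + 1)) :=
        (contDiff_pi.1 contDiff_snd I).contDiffOn.sub (contDiffOn_pi.1 hgτ.snd I)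
      exact (EuclideanSpace.proj α : Euc m →L[ℝ] ℝ).contDiff.comp_contDiffOn h1
    · rintro _ hθ ⟨θ, rfl⟩
      have hθ' := (D.mem_jetSource_toFun c).1 hθ
      have h1 : τ (c.jetCoord (s + 1) (D.toFun θ)) = c.jetCoord s θ :=
        (D.jetCoord_toFun c hθ').symm
      simp only [h1, ← hg.2 θ hθ', sub_self]
      rfl
  ext v α
  have := hα α
  rw [(EuclideanSpace.proj α : Euc m →L[ℝ] ℝ).iteratedFDeriv_comp_left hsub
    (by exact_mod_cast le_top)] at this
  exact congrArg (fun T => T v) this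

/-- Sections which are tangent to the image of a connection to every order at a common base point
are determined, up to infinite order, by their `s`-jets. -/
theorem jet_top_eq_of_isTangentUpTo {p q : PointedSection n m π}
    (hp : ∀ r, IsTangentUpTo (Set.range D.toFun) r p)
    (hq : ∀ r, IsTangentUpTo (Set.range D.toFun) r q) (h : p.jet s = q.jet s) :
    p.jet ⊤ = q.jet ⊤ := by
  obtain ⟨hpt, hpq, hI⟩ : SameJet n m s p q := Quotient.exact h
  refine Quotient.sound ⟨hpt, hpq, fun c hc I _ => ?_⟩
  obtain ⟨g, hg⟩ : ∃ g, D.IsLocalExpr c g := D.smooth c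
  have hcq : q.sec q.pt ∈ c.toE.source := hpq ▸ hc
  have hjet : jetMap s (c.rep p.sec) (c.toM p.pt) = jetMap s (c.rep q.sec) (c.toM q.pt) := by
    rw [← c.jetCoord_jet s hc, ← c.jetCoord_jet s hcq, h]
  have hpz : jetMap s (c.rep p.sec) (c.toM p.pt) ∈ c.jetTarget s := by
    rw [← c.jetCoord_jet s hc]
    exact c.jetCoord_mem_jetTarget hc
  have hgp := hg.agreeTo_of_isTangentUpTo hc hp
  have hgq := hg.agreeTo_of_isTangentUpTo hcq hq
  have hup := c.eventually_contDiffAt_rep hc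
  have huq := c.eventually_contDiffAt_rep hcq
  rw [← hpt] at hgq huq hjet ⊢
  exact (agreeTo_iff_partialDeriv hup huq).1 (agreeTo_of_formal_solution hup huq
    (hg.1.contDiffAt ((c.isOpen_jetTarget s).mem_nhds hpz)) hjet hgp hgq _) I le_rfl

theorem leaf_spec {θ : Jet n m π s}
    (h : ∃ p : PointedSection n m π, p.jet s = θ ∧ D.IsConstantAt p) :
    (D.leaf θ).jet s = θ ∧ D.IsConstantAt (D.leaf θ) := by
  rw [leaf, dif_pos h]
  exact h.choose_spec

end HolonomicConnection

theorem PointedSection.jet_eq_of_jet_top_eq {p q : PointedSection n m π} (h : p.jet ⊤ = q.jet ⊤)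
    (k : ℕ∞) : p.jet k = q.jet k :=
  congrArg (Jet.trunc k le_top) h

end Connections

end

theorem mainTheorem6 {n m s k : ℕ} (hsk : s < k)
    {M : Type*} [TopologicalSpace M] [ChartedSpace (Euc n) M] [IsManifold (𝓡 n) ∞ M]
    [T2Space M] [SecondCountableTopology M]
    {E : Type*} [TopologicalSpace E] [ChartedSpace (Euc (n + m)) E]
    [IsManifold (𝓡 (n + m)) ∞ E] [T2Space E] [SecondCountableTopology E]
    {N : Type*} [TopologicalSpace N] [ChartedSpace (Euc m) N] [IsManifold (𝓡 m) ∞ N]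
    {π : E → M} (hπ : IsSmoothFiberBundle n m N π)
    {W : Type*} [NormedAddCommGroup W] [NormedSpace ℝ W] [FiniteDimensional ℝ W]
    {V : M → Type*} [TopologicalSpace (Bundle.TotalSpace W V)] [∀ x, AddCommGroup (V x)]
    [∀ x, Module ℝ (V x)] [∀ x, TopologicalSpace (V x)] [FiberBundle W V] [VectorBundle ℝ W V]
    [ContMDiffVectorBundle ∞ W V (𝓡 n)]
    (F : (θ : Jet n m π k) → V θ.base)
    (hF : IsSmoothOnJets ((𝓡 n).prod 𝓘(ℝ, W))
      (fun θ => (⟨θ.base, F θ⟩ : Bundle.TotalSpace W V)))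
    (D : HolonomicConnection n m π s) (hD : D.IsFlat) :
    infProlongation (Set.range D.toFun) ⊆ infProlongation {θ : Jet n m π k | F θ = 0} ↔
      ∀ θ : Jet n m π s, F (D.bracket k θ) = 0 := by
  have hleaf : ∀ θ, (D.leaf θ).jet s = θ ∧ D.IsConstantAt (D.leaf θ) := fun θ =>
    HolonomicConnection.leaf_spec (hD.exists_isConstantAt hπ θ)
  constructor
  · intro h θ
    obtain ⟨q, hq, hqt⟩ := h ⟨D.leaf θ, rfl, (hleaf θ).2.isTangentUpTo⟩
    have hqF : q.jet k ∈ {θ : Jet n m π k | F θ = 0} := (hqt 0).1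
    rwa [PointedSection.jet_eq_of_jet_top_eq hq k] at hqF
  · rintro h _ ⟨q, rfl, hq⟩
    obtain ⟨hp, hpc⟩ := hleaf (q.jet s)
    refine ⟨D.leaf (q.jet s), HolonomicConnection.jet_top_eq_of_isTangentUpTo
      hpc.isTangentUpTo hq hp, isTangentUpTo_of_eventually ?_⟩
    filter_upwards [hpc.eventually] with y hy hs
    -- nearby jets of a leaf are jets of the leaves through its nearby `s`-jets
    have hc := hy hs
    obtain ⟨hp', hpc'⟩ := hleaf (PointedSection.jet s ⟨y, (D.leaf (q.jet s)).sec, hs⟩)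
    rw [← PointedSection.jet_eq_of_jet_top_eq (HolonomicConnection.jet_top_eq_of_isTangentUpTo
      hpc'.isTangentUpTo hc.isTangentUpTo hp') k]
    exact h _
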